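/- **Setting.** Let $N\ge 1$ and let $j:\mathbb{RP}^{N-1}\to\mathbb R^{N\times N}$, $j([x])=xx^t$ for $\|x\|=1$, be the Veronese–Whitney (VW) embedding; $\mathbb R^{N\times N}$ carries the Frobenius norm. A matrix $A$ is $\alpha$-nonfocal if exactly one point of $j(\mathbb{RP}^{N-1})$ is farthest from $A$; that point is $P_F(A)$. For an orthonormal basis $g=(g_1,\dots,g_N)$ of $\mathbb R^N$ put $e_a(g)=d_{[g_1]}j(g_a)=g_1g_a^t+g_ag_1^t$, $a=2,\dots,N$, an orthogonal basis of the tangent space of $j(\mathbb{RP}^{N-1})$ at $j([g_1])$, and let $\tan_g(v)\in\mathbb R^{N-1}$ be the coordinates in this basis of the orthogonal projection of $v$ on the tangent space. For a probability measure $Q$ on $\mathbb{RP}^{N-1}$ let $\mu_Q=\int j\,dQ$ and let $\Sigma_Q$ be the covariance matrix of $j(Q)$. If $\mu_Q$ is $\alpha$-nonfocal and $j([g_1])=P_F(\mu_Q)$, the anticovariance matrix of $Q$ in the frame $g$ is $\alpha\Sigma(Q,g)=L\Sigma_QL^t$, where $L$ is the matrix of $\tan_g\circ d_{\mu_Q}P_F$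 with respect to the canonical basis of $\mathbb R^{N\times N}$. **Data.** Let $[X_1],[X_2],\dots$, $\|X_r\|=1$, be i.i.d. with law $Q$ on $\mathbb{RP}^{N-1}$. Assume that $Q$ is $\alpha$-nonfocal (that is, $\mu=\mu_Q=E(XX^t)$ is an $\alpha$-nonfocal point). Let $\nu=(\nu_1,\dots,\nu_N)$ be orthonormal eigenvectors of $\mu$, for its eigenvalues in increasing order, and assume that the anticovariance matrix $\alpha\Sigma(Q,\nu)$ is nondegenerate. Let $A\mapsto F(A)=(F_1(A),\dots,F_N(A))$ be a continuous moving frame on a neighbourhood $U$ of $\mu$ which is adapted to $j$ and extends $\nu$: every $A\in U$ is $\alpha$-nonfocal, $F(A)$ is an orthonormal basis of $\mathbb R^N$, $j([F_1(A)])=P_F(A)$, and $F(\mu)=\nu$. Let $K_n=\frac1n\sum_{r\le n}X_rX_r^t$, let $m=m_n=F_1(K_n)$ be the unit vector representing the sample VW antimean, and let $aS_{E,n}=\alpha\Sigma(\hat Q_n,F(K_n))$ be the sample anticovariance matrix, where $\hat Q_n$ is the empirical distribution. Put $$T_n([\nu_1])=n\,\bigl\|aS_{E,n}^{-1/2}\tan_\nu\bigl(P_F(K_n)-P_F(\mu)\bigr)\bigr\|^2,\qquad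 \widetilde T_n=n\,m^t[(\nu_a)_{a=2,\dots,N}]\,aS_{E,n}^{-1}\,[(\nu_a)_{a=2,\dots,N}]^t\,m .$$ **Theorem.** The probability that $K_n\in U$ and $aS_{E,n}$ is invertible tends to $1$ as $n\to\infty$, and on this event $T_n([\nu_1])=(\nu_1\cdot m)^2\,\widetilde T_n$. Moreover $T_n([\nu_1])-\widetilde T_n\to0$ in probability, so that $T_n([\nu_1])$ is given, up to a term that is asymptotically negligible, by the quadratic form $\widetilde T_n$. Both $T_n([\nu_1])$ and $\widetilde T_n$ converge in law to the $\chi^2_{N-1}$ distribution. -/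

import Mathlib

open MeasureTheory ProbabilityTheory Filter Topology Set
open scoped Matrix InnerProductSpace ENNReal LinearAlgebra.Projectivization

noncomputable section

/-! ### Farthest projection and anticovariance of an embedding `j : M → ℝ^κ` -/

section Extrinsic

variable {M : Type*} {κ : Type*} [Fintype κ] [DecidableEq κ]

/-- `x` is a farthest point of `M` from `p`, for the chord distance. -/
def IsFarthestPoint (j : M → EuclideanSpace ℝ κ) (p : EuclideanSpace ℝ κ) (x : M) : Prop :=
  ∀ y, dist p (j y) ≤ dist p (j x)

/-- `p` is `αj`-nonfocal: there is exactly one point of `M` farthest from `p`. -/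
def IsAntiNonfocal (j : M → EuclideanSpace ℝ κ) (p : EuclideanSpace ℝ κ) : Prop :=
  ∃! x, IsFarthestPoint j p x

open Classical in
/-- The farthest projection `P_{F,j}`, defined on the nonfocal points (and `0` elsewhere). -/
def farthestProj (j : M → EuclideanSpace ℝ κ) (p : EuclideanSpace ℝ κ) : EuclideanSpace ℝ κ :=
  if h : IsAntiNonfocal j p then j h.exists.choose else 0

/-- Coordinates, with respect to an orthogonal frame `e` of a linear subspace, of the orthogonal
projection `tan v` of `v` on that subspace. When `e a = dj (f a)` these are the coordinates of
`(dj)⁻¹ (tan v)` with respect to `f`. -/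
def tanCoord {ι : Type*} (e : ι → EuclideanSpace ℝ κ) (v : EuclideanSpace ℝ κ) : ι → ℝ :=
  fun a => ⟪e a, v⟫_ℝ / ‖e a‖ ^ 2

variable [MeasurableSpace M]

/-- The mean `μ` of `j(Q)`. -/
def extMean (j : M → EuclideanSpace ℝ κ) (Q : Measure M) : EuclideanSpace ℝ κ :=
  ∫ x, j x ∂Q

/-- The covariance matrix `Σ` of `j(Q)`. -/
def extCov (j : M → EuclideanSpace ℝ κ) (Q : Measure M) : Matrix κ κ ℝ :=
  Matrix.of fun p q => ∫ x, (j x p - extMean j Q p) * (j x q - extMean j Q q) ∂Q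

/-- The matrix of `d_μ P_{F,j}`, from the canonical basis of `ℝ^κ` to the frame `e` of the tangent
space at `P_{F,j}(μ)`. -/
def dFarthestProj {ι : Type*} (j : M → EuclideanSpace ℝ κ) (Q : Measure M)
    (e : ι → EuclideanSpace ℝ κ) : Matrix ι κ ℝ :=
  Matrix.of fun a b =>
    tanCoord e (fderiv ℝ (farthestProj j) (extMean j Q) (EuclideanSpace.single b 1)) a

/-- The anticovariance matrix of `Q` with respect to a frame `e` of the tangent space of `j(M)` at
`P_{F,j}(μ)`. -/
def anticov {ι : Type*} (j : M → EuclideanSpace ℝ κ) (Q : Measure M)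
    (e : ι → EuclideanSpace ℝ κ) : Matrix ι ι ℝ :=
  dFarthestProj j Q e * extCov j Q * (dFarthestProj j Q e)ᵀ

/-- The empirical distribution `n⁻¹ ∑_{r < n} δ_{Y r}`. -/
def empirical {Ω : Type*} (Y : ℕ → Ω → M) (n : ℕ) (ω : Ω) : Measure M :=
  (n : ℝ≥0∞)⁻¹ • ∑ r ∈ Finset.range n, Measure.dirac (Y r ω)

end Extrinsic

/-- `S^{-1/2}` for a positive definite matrix `S`, by the spectral functional calculus. -/
def invSqrt {ι : Type*} [Fintype ι] [DecidableEq ι] (S : Matrix ι ι ℝ) : Matrix ι ι ℝ :=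
  cfc (fun t : ℝ => (√t)⁻¹) S

/-! ### Real projective space and its Veronese-Whitney embedding -/

/-- The real projective space `ℝP^{N-1}`. -/
def RealProj (N : ℕ) : Type := ℙ ℝ (EuclideanSpace ℝ (Fin N))

/-- The quotient topology. -/
instance (N : ℕ) : TopologicalSpace (RealProj N) :=
  TopologicalSpace.coinduced (Projectivization.mk' ℝ) inferInstance

instance (N : ℕ) : MeasurableSpace (RealProj N) := borel _

instance (N : ℕ) : BorelSpace (RealProj N) := ⟨rfl⟩

/-- The matrix `x yᵀ`, as a point of the Euclidean space of `N × N` matrices, whose norm is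
the Frobenius norm. -/
def outerProd {N : ℕ} (x y : EuclideanSpace ℝ (Fin N)) : EuclideanSpace ℝ (Fin N × Fin N) :=
  WithLp.toLp 2 fun p => x p.1 * y p.2

/-- The Veronese-Whitney embedding `[x] ↦ x xᵀ / ‖x‖²`. -/
def vw {N : ℕ} : RealProj N → EuclideanSpace ℝ (Fin N × Fin N) :=
  Projectivization.lift (fun x => (‖(x : EuclideanSpace ℝ (Fin N))‖ ^ 2)⁻¹ • outerProd x.1 x.1) <| by
    rintro ⟨_, ha⟩ ⟨b, hb⟩ t rfl
    have ht : t ≠ 0 := by rintro rfl; simp at ha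
    have hb' : ‖b‖ ≠ 0 := by simpa using hb
    ext p
    simp only [outerProd, norm_smul, PiLp.smul_apply, smul_eq_mul, Real.norm_eq_abs, mul_pow, sq_abs]
    field_simp

/-- For a unit vector `x` and `v ⊥ x`, the image `d_{[x]}j (v) = x vᵀ + v xᵀ` of the tangent vector
`v` of `ℝP^{N-1}` at `[x]` under the differential of the Veronese-Whitney embedding. -/
def vwTangent {N : ℕ} (x v : EuclideanSpace ℝ (Fin N)) : EuclideanSpace ℝ (Fin N × Fin N) :=
  outerProd x v + outerProd v x

/-- For an orthonormal basis `g` of `ℝ^{d+1}`, the frame `d_{[x]}j (g_a)`, `a ≠ 0`, of the tangent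
space of `j(ℝP^d)` at `j[x]`, where `x = g_0`. -/
def vwFrame {d : ℕ} (g : Fin (d + 1) → EuclideanSpace ℝ (Fin (d + 1))) :
    Fin d → EuclideanSpace ℝ (Fin (d + 1) × Fin (d + 1)) :=
  fun a => vwTangent (g 0) (g a.succ)

/-- The `N × N` matrix with the entries of a point of `ℝ^{N × N}`. -/
def asMatrix {N : ℕ} (A : EuclideanSpace ℝ (Fin N × Fin N)) : Matrix (Fin N) (Fin N) ℝ :=
  Matrix.of fun i k => A (i, k)

/-- `F` is a continuous moving frame on the neighbourhood `U` of `A₀`, adapted to the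
Veronese-Whitney embedding: for `A ∈ U`, `A` is nonfocal, `F A` is an orthonormal basis of
`ℝ^{d+1}`, and `P_{F,j}(A) = j[F_0 A]`, so that `F_1 A, …, F_d A` is an orthonormal basis of the
tangent space of `ℝP^d` at the point whose image is `P_{F,j}(A)`. -/
structure IsAdaptedFrame {d : ℕ} (U : Set (EuclideanSpace ℝ (Fin (d + 1) × Fin (d + 1))))
    (A₀ : EuclideanSpace ℝ (Fin (d + 1) × Fin (d + 1)))
    (F : EuclideanSpace ℝ (Fin (d + 1) × Fin (d + 1)) →
      Fin (d + 1) → EuclideanSpace ℝ (Fin (d + 1))) : Prop where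
  mem_nhds : U ∈ 𝓝 A₀
  continuousOn : ContinuousOn F U
  nonfocal : ∀ A ∈ U, IsAntiNonfocal vw A
  orthonormal : ∀ A ∈ U, Orthonormal ℝ (F A)
  proj : ∀ A ∈ U, outerProd (F A 0) (F A 0) = farthestProj vw A

section Statistic

variable {d : ℕ} {Ω : Type*}

/-- The sample mean `n⁻¹ ∑ X_r X_rᵀ` of `j(X)`. -/
def sampleMean (Y : ℕ → Ω → RealProj (d + 1)) (n : ℕ) (ω : Ω) :
    EuclideanSpace ℝ (Fin (d + 1) × Fin (d + 1)) :=
  extMean vw (empirical Y n ω)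

/-- The sample anticovariance matrix: the anticovariance matrix of the empirical distribution,
with respect to the moving frame `F`. -/
def sampleAnticov (Y : ℕ → Ω → RealProj (d + 1))
    (F : EuclideanSpace ℝ (Fin (d + 1) × Fin (d + 1)) →
      Fin (d + 1) → EuclideanSpace ℝ (Fin (d + 1))) (n : ℕ) (ω : Ω) : Matrix (Fin d) (Fin d) ℝ :=
  anticov vw (empirical Y n ω) (vwFrame (F (sampleMean Y n ω)))

/-- The statistic `n ‖aS^{-1/2} tan (P_F(sample mean) - P_F(E j(Q)))‖²`, where `tan` is
the tangential component at `P_F(E j(Q)) = j[ν_0]`. -/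
def statT (Q : Measure (RealProj (d + 1)))
    (ν : Fin (d + 1) → EuclideanSpace ℝ (Fin (d + 1))) (Y : ℕ → Ω → RealProj (d + 1))
    (F : EuclideanSpace ℝ (Fin (d + 1) × Fin (d + 1)) →
      Fin (d + 1) → EuclideanSpace ℝ (Fin (d + 1))) (n : ℕ) (ω : Ω) : ℝ :=
  n * ‖WithLp.toLp 2 (invSqrt (sampleAnticov Y F n ω) *ᵥ
    tanCoord (vwFrame ν)
      (farthestProj vw (sampleMean Y n ω) - farthestProj vw (extMean vw Q)))‖ ^ 2

/-- The `N × (N-1)` matrix `[(ν_a)_{a ≠ 0}]`. -/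
def colsTail (ν : Fin (d + 1) → EuclideanSpace ℝ (Fin (d + 1))) :
    Matrix (Fin (d + 1)) (Fin d) ℝ :=
  Matrix.of fun i a => ν a.succ i

/-- The quadratic form `n mᵗ [(ν_a)_{a ≠ 0}] aS⁻¹ [(ν_a)_{a ≠ 0}]ᵗ m`, where `m = F_0(sample mean)`
is the unit vector that represents the sample antimean. -/
def quadT (ν : Fin (d + 1) → EuclideanSpace ℝ (Fin (d + 1))) (Y : ℕ → Ω → RealProj (d + 1))
    (F : EuclideanSpace ℝ (Fin (d + 1) × Fin (d + 1)) →
      Fin (d + 1) → EuclideanSpace ℝ (Fin (d + 1))) (n : ℕ) (ω : Ω) : ℝ :=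
  n * ((F (sampleMean Y n ω) 0).ofLp ⬝ᵥ
    ((colsTail ν * (sampleAnticov Y F n ω)⁻¹ * (colsTail ν)ᵀ) *ᵥ (F (sampleMean Y n ω) 0).ofLp))

end Statistic

/-- The `χ²` distribution with `d` degrees of freedom. -/
def chiSq (d : ℕ) : Measure ℝ :=
  (Measure.pi fun _ : Fin d => gaussianReal 0 1).map fun z => ∑ a, z a ^ 2

/-- Convergence in law of `T n` to `ρ`: convergence of the distribution functions at the continuity
points of the limit. -/
def HasAsymptoticLaw {Ω : Type*} [MeasurableSpace Ω] (P : Measure Ω) (T : ℕ → Ω → ℝ)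
    (ρ : Measure ℝ) : Prop :=
  ∀ t : ℝ, ρ {t} = 0 → Tendsto (fun n => P {ω | T n ω ≤ t}) atTop (𝓝 (ρ (Iic t)))

end

noncomputable section

/-! ### The Veronese-Whitney embedding -/

section VeroneseWhitney

variable {N : ℕ}

/-! All points of the Veronese–Whitney image have norm `1`, so a farthest point from `A` is an `xxᵗ`
minimizing the quadratic form `⟪A, xxᵗ⟫`: `x` spans the lowest eigenspace of the symmetric part of
`A`, and nonfocality says that this eigenvalue is simple. A continuous unit eigenvector for a simple
eigenvalue is `C¹` by the inverse function theorem (`contDiffAt_of_simple_eigenvector`), so `P_F` is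
`C¹` at the mean `μ`.

The relation between the two statistics is algebraic. The tangential coordinates of `mmᵗ - ν₀ν₀ᵗ`
are `(ν₀·m)(νₐ·m)` (`tanCoord_vwFrame_outerProd_sub`), and `‖S^{-1/2}v‖² = vᵗS⁻¹v` once `S` is
positive definite, so the factor `(ν₀·m)²` comes out (`statT_eq_mul_quadT`). It tends to `1` in
probability.

For the limit law, write `Z_n = √n (K_n - μ)` and let `L` be the matrix of the differential of
`P_F`. The delta method replaces `√n tan(P_F(K_n) - P_F(μ))` by `L Z_n` up to `o(‖Z_n‖)`, and the
sample anticovariance converges to `S = LΣLᵗ` by the law of large numbers and continuity of the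
derivative. Hence the statistic is `(L Z_n)ᵗ S⁻¹ (L Z_n) + o(‖Z_n‖²)`, where the error is negligible
because `Z_n` is bounded in `L²`. The vectors `S^{-1/2}L(XXᵗ - μ)` are centered with identity
covariance, so the central limit theorem gives the squared norm of a standard Gaussian vector.

Neither the frame nor the statistics are known to be measurable. Convergence in outer probability is
therefore encoded by the filter `inProb`, which makes the usual calculus of limits and of `o`, `O`
available. -/

lemma inner_outerProd (x y z w : EuclideanSpace ℝ (Fin N)) :
    ⟪outerProd x y, outerProd z w⟫_ℝ = ⟪x, z⟫_ℝ * ⟪y, w⟫_ℝ := by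
  simp only [outerProd, PiLp.inner_apply, RCLike.inner_apply, conj_trivial, Fintype.sum_prod_type,
    Finset.sum_mul_sum]
  exact Finset.sum_congr rfl fun i _ => Finset.sum_congr rfl fun k _ => by ring

lemma norm_outerProd_self (x : EuclideanSpace ℝ (Fin N)) : ‖outerProd x x‖ = ‖x‖ ^ 2 := by
  have h := inner_outerProd x x x x
  rw [real_inner_self_eq_norm_sq, real_inner_self_eq_norm_sq] at h
  have : ‖outerProd x x‖ ^ 2 = (‖x‖ ^ 2) ^ 2 := by rw [h]; ring
  exact (sq_eq_sq₀ (norm_nonneg _) (by positivity)).1 this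

lemma outerProd_smul_smul (c : ℝ) (x : EuclideanSpace ℝ (Fin N)) :
    outerProd (c • x) (c • x) = c ^ 2 • outerProd x x := by
  ext p
  simp [outerProd]
  ring

lemma contDiff_outerProd : ContDiff ℝ 1
    fun x : EuclideanSpace ℝ (Fin N) × EuclideanSpace ℝ (Fin N) => outerProd x.1 x.2 := by
  rw [contDiff_euclidean]
  intro p
  simp only [outerProd]
  fun_prop

lemma exists_unit_vw (p : RealProj N) :
    ∃ x : EuclideanSpace ℝ (Fin N), ‖x‖ = 1 ∧ vw p = outerProd x x := by
  induction p using Projectivization.ind with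
  | h v hv =>
    have hv' : ‖v‖ ≠ 0 := by simpa using hv
    refine ⟨‖v‖⁻¹ • v, by simp [norm_smul, hv'], ?_⟩
    rw [outerProd_smul_smul, inv_pow]
    rfl

lemma exists_vw_eq {x : EuclideanSpace ℝ (Fin N)} (hx : ‖x‖ = 1) :
    ∃ p : RealProj N, vw p = outerProd x x := by
  have h0 : x ≠ 0 := by rintro rfl; simp at hx
  refine ⟨Projectivization.mk ℝ x h0, ?_⟩
  change (‖x‖ ^ 2)⁻¹ • outerProd x x = _
  simp [hx]

lemma norm_vw (p : RealProj N) : ‖vw p‖ = 1 := by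
  obtain ⟨x, hx, h⟩ := exists_unit_vw p
  rw [h, norm_outerProd_self, hx, one_pow]

lemma continuous_vw : Continuous (vw (N := N)) := by
  refine continuous_coinduced_dom.2 ?_
  change Continuous fun x : {v : EuclideanSpace ℝ (Fin N) // v ≠ 0} =>
    (‖(x : EuclideanSpace ℝ (Fin N))‖ ^ 2)⁻¹ • outerProd x.1 x.1
  have h2 : ∀ x : {v : EuclideanSpace ℝ (Fin N) // v ≠ 0},
      ‖(x : EuclideanSpace ℝ (Fin N))‖ ^ 2 ≠ 0 := fun x => by simpa using x.2
  exact ((continuous_subtype_val.norm.pow 2).inv₀ h2).smul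
    (contDiff_outerProd.continuous.comp (continuous_subtype_val.prodMk continuous_subtype_val))

lemma measurable_vw : Measurable (vw (N := N)) := continuous_vw.measurable

/-- Farthest points of the Veronese-Whitney image minimize the quadratic form of the matrix. -/
lemma isFarthestPoint_vw_iff {A : EuclideanSpace ℝ (Fin N × Fin N)} {p : RealProj N} :
    IsFarthestPoint vw A p ↔ ∀ q, ⟪A, vw p⟫_ℝ ≤ ⟪A, vw q⟫_ℝ := by
  refine forall_congr' fun q => ?_
  rw [dist_eq_norm, dist_eq_norm, ← sq_le_sq₀ (norm_nonneg _) (norm_nonneg _),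
    norm_sub_sq_real, norm_sub_sq_real, norm_vw, norm_vw]
  constructor <;> intro h <;> linarith

lemma farthestProj_spec {M κ : Type*} [Fintype κ] [DecidableEq κ] {j : M → EuclideanSpace ℝ κ}
    {p : EuclideanSpace ℝ κ} (h : IsAntiNonfocal j p) :
    ∃ x, IsFarthestPoint j p x ∧ farthestProj j p = j x := by
  refine ⟨h.exists.choose, h.exists.choose_spec, ?_⟩
  rw [farthestProj, dif_pos h]

/-- Twice the symmetric part of a square matrix, as an operator. -/
def symOp (N : ℕ) : EuclideanSpace ℝ (Fin N × Fin N) →L[ℝ]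
    EuclideanSpace ℝ (Fin N) →L[ℝ] EuclideanSpace ℝ (Fin N) :=
  (LinearMap.toContinuousLinearMap.toLinearMap ∘ₗ LinearMap.mk₂ ℝ
    (fun A x => WithLp.toLp 2 fun i => ∑ k, (A (i, k) + A (k, i)) * x k)
    (fun A B x => by ext i; simp [← Finset.sum_add_distrib]; congr! 1; ring)
    (fun c A x => by ext i; simp [Finset.mul_sum]; congr! 1; ring)
    (fun A x y => by ext i; simp [← Finset.sum_add_distrib]; congr! 1; ring)
    (fun c A x => by ext i; simp [Finset.mul_sum]; congr! 1; ring)).toContinuousLinearMap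

lemma symOp_apply (A : EuclideanSpace ℝ (Fin N × Fin N)) (x : EuclideanSpace ℝ (Fin N))
    (i : Fin N) : symOp N A x i = ∑ k, (A (i, k) + A (k, i)) * x k := rfl

/-- On the diagonal this is `2⟪A, xxᵗ⟫`, the form minimized by farthest points. Symmetrizing is
needed because the neighbourhood `U` also contains nonsymmetric matrices. -/
lemma inner_symOp (A : EuclideanSpace ℝ (Fin N × Fin N)) (x y : EuclideanSpace ℝ (Fin N)) :
    ⟪symOp N A x, y⟫_ℝ = ⟪A, outerProd x y⟫_ℝ + ⟪A, outerProd y x⟫_ℝ := by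
  simp only [outerProd, PiLp.inner_apply, RCLike.inner_apply, conj_trivial, Fintype.sum_prod_type,
    symOp_apply, Finset.mul_sum]
  rw [Finset.sum_comm (f := fun i k => x.ofLp i * y.ofLp k * _), ← Finset.sum_add_distrib]
  simp_rw [← Finset.sum_add_distrib]
  exact Finset.sum_congr rfl fun i _ => Finset.sum_congr rfl fun k _ => by ring

lemma isSymmetric_symOp (A : EuclideanSpace ℝ (Fin N × Fin N)) :
    (symOp N A : EuclideanSpace ℝ (Fin N) →ₗ[ℝ] EuclideanSpace ℝ (Fin N)).IsSymmetric := by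
  intro x y
  change ⟪symOp N A x, y⟫_ℝ = ⟪x, symOp N A y⟫_ℝ
  rw [inner_symOp, real_inner_comm (symOp N A y) x, inner_symOp, add_comm]

lemma inner_le_of_farthestProj {A : EuclideanSpace ℝ (Fin N × Fin N)} (hA : IsAntiNonfocal vw A)
    {x y : EuclideanSpace ℝ (Fin N)} (hx : outerProd x x = farthestProj vw A) (hy : ‖y‖ = 1) :
    ⟪A, outerProd x x⟫_ℝ ≤ ⟪A, outerProd y y⟫_ℝ := by
  obtain ⟨p, hp, hpe⟩ := farthestProj_spec hA
  obtain ⟨q, hq⟩ := exists_vw_eq hy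
  rw [hx, hpe, ← hq]
  exact isFarthestPoint_vw_iff.1 hp q

/-- The representative of the farthest projection is an eigenvector of the symmetric part. -/
lemma symOp_eq_smul_of_farthestProj {A : EuclideanSpace ℝ (Fin N × Fin N)}
    (hA : IsAntiNonfocal vw A) {x : EuclideanSpace ℝ (Fin N)} (hn : ‖x‖ = 1)
    (hx : outerProd x x = farthestProj vw A) :
    symOp N A x = ⟪symOp N A x, x⟫_ℝ • x := by
  -- A constrained extremum of the quadratic form on the sphere is an eigenvector, by Lagrange
  -- multipliers.
  have hmin : IsMinOn (symOp N A).reApplyInnerSelf (Metric.sphere 0 ‖x‖) x := by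
    intro y hy
    rw [mem_sphere_zero_iff_norm, hn] at hy
    change (symOp N A).reApplyInnerSelf x ≤ (symOp N A).reApplyInnerSelf y
    have := inner_le_of_farthestProj hA hx hy
    simp only [ContinuousLinearMap.reApplyInnerSelf_apply, RCLike.re_to_real, inner_symOp]
    linarith
  have h := (isSymmetric_symOp A).isSelfAdjoint.eq_smul_self_of_isLocalExtrOn
    (Or.inl hmin.localize)
  simpa [ContinuousLinearMap.rayleighQuotient, ContinuousLinearMap.reApplyInnerSelf_apply, hn]
    using h

/-- The eigenvalue of the farthest projection is simple. -/
lemma mem_span_of_symOp_eq {A : EuclideanSpace ℝ (Fin N × Fin N)}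
    (hA : IsAntiNonfocal vw A) {x v : EuclideanSpace ℝ (Fin N)} (hn : ‖x‖ = 1)
    (hx : outerProd x x = farthestProj vw A) (hv : symOp N A v = ⟪symOp N A x, x⟫_ℝ • v) :
    ∃ c : ℝ, v = c • x := by
  rcases eq_or_ne v 0 with rfl | hv0
  · exact ⟨0, by simp⟩
  have hv0' : ‖v‖ ≠ 0 := by simpa using hv0
  set u := ‖v‖⁻¹ • v with hu
  have hun : ‖u‖ = 1 := by simp [hu, norm_smul, hv0']
  -- A unit vector with the same eigenvalue attains the same minimum, so it represents another
  -- farthest point; uniqueness then applies.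
  have huA : ⟪A, outerProd u u⟫_ℝ = ⟪A, outerProd x x⟫_ℝ := by
    have h1 : ⟪symOp N A u, u⟫_ℝ = ⟪symOp N A x, x⟫_ℝ := by
      have : symOp N A u = ⟪symOp N A x, x⟫_ℝ • u := by
        rw [hu, map_smul, hv, smul_comm]
      rw [this, inner_smul_left, real_inner_self_eq_norm_sq, hun]
      simp
    rw [inner_symOp, inner_symOp] at h1
    linarith
  obtain ⟨p, hp, hpe⟩ := farthestProj_spec hA
  obtain ⟨q, hq⟩ := exists_vw_eq hun
  have hqp : q = p := hA.unique (isFarthestPoint_vw_iff.2 fun r => by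
    rw [hq, huA, hx, hpe]; exact isFarthestPoint_vw_iff.1 hp r) hp
  have hux : outerProd u u = outerProd x x := by rw [← hq, hqp, ← hpe, hx]
  have h1 : ⟪u, x⟫_ℝ ^ 2 = 1 := by
    have := inner_outerProd u u x x
    rw [hux, real_inner_self_eq_norm_sq, norm_outerProd_self, hn] at this
    nlinarith
  refine ⟨‖v‖ * ⟪u, x⟫_ℝ, ?_⟩
  -- Equality case of Cauchy–Schwarz: for unit vectors the left side is `1 - ⟪u, x⟫²`.
  have h2 : ‖u - ⟪u, x⟫_ℝ • x‖ ^ 2 = 0 := by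
    rw [norm_sub_sq_real, inner_smul_right, norm_smul _ x, hun, hn, Real.norm_eq_abs,
      mul_one, sq_abs]
    nlinarith
  have h3 : u = ⟪u, x⟫_ℝ • x := by
    rw [← sub_eq_zero, ← norm_eq_zero]; exact pow_eq_zero_iff (two_ne_zero) |>.1 h2
  rw [mul_smul, ← h3, hu, smul_smul, mul_inv_cancel₀ hv0', one_smul]

end VeroneseWhitney

/-! ### Smooth dependence of a simple eigenvector -/

/-- A continuous choice of unit eigenvectors is continuously differentiable at a point where
the operator is symmetric and the eigenvalue is simple. -/
lemma contDiffAt_of_simple_eigenvector {V E : Type*} [NormedAddCommGroup V] [NormedSpace ℝ V]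
    [FiniteDimensional ℝ V] [NormedAddCommGroup E] [InnerProductSpace ℝ E] [FiniteDimensional ℝ E]
    (T : V →L[ℝ] E →L[ℝ] E) {x : V → E} {A₀ : V} (hx : ContinuousAt x A₀)
    (hn : ∀ᶠ A in 𝓝 A₀, ‖x A‖ = 1)
    (heig : ∀ᶠ A in 𝓝 A₀, T A (x A) = ⟪T A (x A), x A⟫_ℝ • x A)
    (hsymm : (T A₀ : E →ₗ[ℝ] E).IsSymmetric)
    (hsimple : ∀ v, T A₀ v = ⟪T A₀ (x A₀), x A₀⟫_ℝ • v → ∃ c : ℝ, v = c • x A₀) :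
    ContDiffAt ℝ 1 x A₀ := by
  set l : V → ℝ := fun A => ⟪T A (x A), x A⟫_ℝ with hl
  have hlc : ContinuousAt l A₀ := by
    have h1 : ContinuousAt (fun A => T A (x A)) A₀ := T.continuous.continuousAt.clm_apply hx
    exact h1.inner hx
  -- The eigenvector equations in the unknowns (vector, eigenvalue), with the parameter `A` carried
  -- along: inverting `G` at `(A, 0, 1)` solves them as a function of `A`.
  set G : V × E × ℝ → V × E × ℝ :=
    fun z => (z.1, T z.1 z.2.1 - z.2.2 • z.2.1, ⟪z.2.1, z.2.1⟫_ℝ) with hG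
  set a : V × E × ℝ := (A₀, x A₀, l A₀) with ha
  have hGs : ContDiff ℝ 1 G := by
    refine contDiff_fst.prodMk (ContDiff.prodMk (ContDiff.sub ?_ ?_) ?_)
    · exact (T.contDiff.comp contDiff_fst).clm_apply (contDiff_fst.comp contDiff_snd)
    · exact (contDiff_snd.comp contDiff_snd).smul (contDiff_fst.comp contDiff_snd)
    · exact (contDiff_fst.comp contDiff_snd).inner ℝ (contDiff_fst.comp contDiff_snd)
  have hGd : HasFDerivAt G (fderiv ℝ G a) a := (hGs.differentiable one_ne_zero a).hasFDerivAt
  -- Directions with zero first component suffice for injectivity, since the derivative preserves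
  -- that component.
  have hlin : ∀ (v : E) (s : ℝ), fderiv ℝ G a (0, v, s) =
      (0, T A₀ v - (l A₀ • v + s • x A₀), 2 * ⟪x A₀, v⟫_ℝ) := by
    intro v s
    have hc : HasDerivAt (fun t : ℝ => a + t • ((0 : V), v, s)) ((0 : V), v, s) 0 := by
      simpa using ((hasDerivAt_id (0 : ℝ)).smul_const ((0 : V), v, s)).const_add a
    have h1 := HasFDerivAt.comp_hasDerivAt (0 : ℝ) (f := fun t : ℝ => a + t • ((0 : V), v, s))
      (l := G) (by simpa using hGd) hc
    have hv : HasDerivAt (fun t : ℝ => x A₀ + t • v) v 0 := by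
      simpa using ((hasDerivAt_id (0 : ℝ)).smul_const v).const_add (x A₀)
    have hs : HasDerivAt (fun t : ℝ => l A₀ + t * s) s 0 := by
      simpa using ((hasDerivAt_id (0 : ℝ)).mul_const s).const_add (l A₀)
    have h2 : HasDerivAt (G ∘ fun t : ℝ => a + t • ((0 : V), v, s))
        (0, T A₀ v - (l A₀ • v + s • x A₀), 2 * ⟪x A₀, v⟫_ℝ) 0 := by
      have e : (G ∘ fun t : ℝ => a + t • ((0 : V), v, s)) = fun t : ℝ =>
          (A₀, T A₀ (x A₀ + t • v) - (l A₀ + t * s) • (x A₀ + t • v),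
            ⟪x A₀ + t • v, x A₀ + t • v⟫_ℝ) := by
        ext t <;> simp [hG, ha]
      rw [e]
      refine (hasDerivAt_const _ _).prodMk (HasDerivAt.prodMk (HasDerivAt.sub ?_ ?_) ?_)
      · exact (T A₀).hasFDerivAt.comp_hasDerivAt (0 : ℝ) hv
      · have := hs.fun_smul hv
        simpa only [zero_mul, add_zero, zero_smul] using this
      · have := hv.inner ℝ hv
        simp only [zero_smul, add_zero] at this
        convert! this using 1
        rw [real_inner_comm v]; ring
    exact h1.unique h2
  have hfst : ∀ z, (fderiv ℝ G a z).1 = z.1 := by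
    intro z
    have h1 : HasFDerivAt (fun z => (G z).1)
        ((ContinuousLinearMap.fst ℝ V (E × ℝ)).comp (fderiv ℝ G a)) a := hGd.fst
    have h2 : HasFDerivAt (fun z => (G z).1) (ContinuousLinearMap.fst ℝ V (E × ℝ)) a :=
      hasFDerivAt_fst
    exact congrArg (fun L => L z) (h1.unique h2)
  have hn0 : ‖x A₀‖ = 1 := hn.self_of_nhds
  have heig0 : T A₀ (x A₀) = l A₀ • x A₀ := heig.self_of_nhds
  have hinj : Function.Injective (fderiv ℝ G a : V × E × ℝ →ₗ[ℝ] V × E × ℝ) := by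
    rw [← LinearMap.ker_eq_bot, LinearMap.ker_eq_bot']
    rintro ⟨B, v, s⟩ h0
    replace h0 : fderiv ℝ G a (B, v, s) = 0 := h0
    have hB : B = 0 := by simpa [h0] using (hfst (B, v, s)).symm
    subst hB
    rw [hlin, Prod.mk_eq_zero, Prod.mk_eq_zero] at h0
    obtain ⟨-, h1, h2⟩ := h0
    have h2' : ⟪x A₀, v⟫_ℝ = 0 := by linarith
    -- Pairing with `x A₀` annihilates `(T A₀ - l A₀) v` by symmetry and leaves only `s`. Simplicity
    -- of the eigenvalue and `v ⊥ x A₀` then give `v = 0`.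
    have hs : s = 0 := by
      have h3 := congrArg (fun w => ⟪x A₀, w⟫_ℝ) h1
      have h4 : ⟪x A₀, T A₀ v⟫_ℝ = ⟪T A₀ (x A₀), v⟫_ℝ := (hsymm (x A₀) v).symm
      simp only [inner_sub_right, inner_add_right, inner_smul_right, inner_zero_right, h2', h4,
        heig0, inner_smul_left, real_inner_self_eq_norm_sq, hn0] at h3
      simpa using h3
    subst hs
    obtain ⟨c, hc⟩ := hsimple v (by simpa [sub_eq_zero] using h1)
    have hc0 : c = 0 := by
      rw [hc, inner_smul_right, real_inner_self_eq_norm_sq, hn0] at h2'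
      simpa using h2'
    simp [hc, hc0]
  set e : (V × E × ℝ) ≃L[ℝ] (V × E × ℝ) :=
    (LinearEquiv.ofInjectiveEndo _ hinj).toContinuousLinearEquiv with he
  have hGe : HasFDerivAt G (e : V × E × ℝ →L[ℝ] V × E × ℝ) a := by
    convert hGd
    ext z <;> rfl
  have hloc := hGs.contDiffAt.to_localInverse (a := a) hGe one_ne_zero
  set inv := hGs.contDiffAt.localInverse (a := a) hGe one_ne_zero with hinv
  have hleft : ∀ᶠ z in 𝓝 a, inv (G z) = z :=
    (hGs.contDiffAt.hasStrictFDerivAt' hGe one_ne_zero).eventually_left_inverse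
  -- Continuity of `x` keeps the curve near `a`, where the local inverse recovers it; this excludes
  -- a change of sign of the eigenvector.
  have hcurve : Tendsto (fun A => (A, x A, l A)) (𝓝 A₀) (𝓝 a) :=
    (tendsto_id.prodMk_nhds (hx.tendsto.prodMk_nhds hlc.tendsto))
  have hGx : ∀ᶠ A in 𝓝 A₀, G (A, x A, l A) = (A, 0, 1) := by
    filter_upwards [hn, heig] with A h1 h2
    simp only [hG, real_inner_self_eq_norm_sq, h1, one_pow]
    rw [h2, sub_self]
  have hGa : G a = (A₀, 0, 1) := hGx.self_of_nhds
  have hxe : x =ᶠ[𝓝 A₀] fun A => (inv (A, 0, 1)).2.1 := by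
    filter_upwards [hcurve.eventually hleft, hGx] with A h1 h2
    rw [← h2, h1]
  refine ContDiffAt.congr_of_eventuallyEq ?_ hxe
  refine ContDiffAt.fst (ContDiffAt.snd (ContDiffAt.comp A₀ (g := inv)
    (f := fun A => (A, (0 : E), (1 : ℝ))) ?_ (contDiffAt_id.prodMk contDiffAt_const)))
  rwa [hGa] at hloc

/-! ### Regularity of the farthest projection and its tangential coordinates. -/

section Smoothness

variable {d : ℕ} {U : Set (EuclideanSpace ℝ (Fin (d + 1) × Fin (d + 1)))}
  {A₀ : EuclideanSpace ℝ (Fin (d + 1) × Fin (d + 1))}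
  {F : EuclideanSpace ℝ (Fin (d + 1) × Fin (d + 1)) →
      Fin (d + 1) → EuclideanSpace ℝ (Fin (d + 1))}

/-- The frame is only assumed continuous; its vector of index `0` gains regularity because it spans
a simple eigenspace. -/
lemma IsAdaptedFrame.contDiffAt_zero (hF : IsAdaptedFrame U A₀ F) :
    ContDiffAt ℝ 1 (fun A => F A 0) A₀ := by
  have hn : ∀ A ∈ U, ‖F A 0‖ = 1 := fun A hA => (hF.orthonormal A hA).1 0
  have h0 := mem_of_mem_nhds hF.mem_nhds
  refine contDiffAt_of_simple_eigenvector (symOp (d + 1)) ?_ ?_ ?_ (isSymmetric_symOp A₀) ?_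
  · exact (continuous_apply 0).continuousAt.comp (hF.continuousOn.continuousAt hF.mem_nhds)
  · filter_upwards [hF.mem_nhds] with A hA using hn A hA
  · filter_upwards [hF.mem_nhds] with A hA
    exact symOp_eq_smul_of_farthestProj (hF.nonfocal A hA) (hn A hA) (hF.proj A hA)
  · intro v hv
    exact mem_span_of_symOp_eq (hF.nonfocal A₀ h0) (hn A₀ h0) (hF.proj A₀ h0) hv

/-- The farthest projection is continuously differentiable where an adapted frame exists. -/
lemma IsAdaptedFrame.contDiffAt_farthestProj (hF : IsAdaptedFrame U A₀ F) :
    ContDiffAt ℝ 1 (farthestProj vw) A₀ := by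
  have h : ContDiffAt ℝ 1 (fun A => outerProd (F A 0) (F A 0)) A₀ :=
    contDiff_outerProd.contDiffAt.comp A₀ (hF.contDiffAt_zero.prodMk hF.contDiffAt_zero)
  refine h.congr_of_eventuallyEq ?_
  filter_upwards [hF.mem_nhds] with A hA using (hF.proj A hA).symm

/-- The matrix of the differential of the farthest projection in the moving frame. -/
def frameDeriv (F : EuclideanSpace ℝ (Fin (d + 1) × Fin (d + 1)) →
      Fin (d + 1) → EuclideanSpace ℝ (Fin (d + 1)))
    (A : EuclideanSpace ℝ (Fin (d + 1) × Fin (d + 1))) :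
    Matrix (Fin d) (Fin (d + 1) × Fin (d + 1)) ℝ :=
  Matrix.of fun a b =>
    tanCoord (vwFrame (F A)) (fderiv ℝ (farthestProj vw) A (EuclideanSpace.single b 1)) a

/-- The cross terms vanish by orthogonality and each of the two remaining terms is `1`, so the frame
is not normalized. -/
lemma norm_vwFrame_sq {g : Fin (d + 1) → EuclideanSpace ℝ (Fin (d + 1))} (hg : Orthonormal ℝ g)
    (a : Fin d) : ‖vwFrame g a‖ ^ 2 = 2 := by
  have h0 : ⟪g 0, g a.succ⟫_ℝ = 0 := hg.2 (Fin.succ_ne_zero a).symm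
  have h0' : ⟪g a.succ, g 0⟫_ℝ = 0 := hg.2 (Fin.succ_ne_zero a)
  rw [← real_inner_self_eq_norm_sq, vwFrame, vwTangent]
  simp only [inner_add_left, inner_add_right, inner_outerProd, real_inner_self_eq_norm_sq (g _),
    hg.1, h0, h0']
  norm_num

/-- The `C¹` property makes the derivative of the projection continuous at `A₀`, and the frame
vectors need only be continuous. Consistency of the sample anticovariance rests on this. -/
lemma IsAdaptedFrame.continuousAt_frameDeriv (hF : IsAdaptedFrame U A₀ F) :
    ContinuousAt (frameDeriv F) A₀ := by
  have hFc := hF.continuousOn.continuousAt hF.mem_nhds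
  have hFa : ∀ a, ContinuousAt (fun A => F A a) A₀ := fun a =>
    (continuous_apply a).continuousAt.comp hFc
  have hfr : ∀ a : Fin d, ContinuousAt (fun A => vwFrame (F A) a) A₀ := fun a =>
    (contDiff_outerProd.continuous.continuousAt.comp
      (f := fun A => (F A 0, F A a.succ)) ((hFa 0).prodMk (hFa a.succ))).add
    (contDiff_outerProd.continuous.continuousAt.comp
      (f := fun A => (F A a.succ, F A 0)) ((hFa a.succ).prodMk (hFa 0)))
  have hd : ContinuousAt (fderiv ℝ (farthestProj (vw (N := d + 1)))) A₀ :=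
    (hF.contDiffAt_farthestProj.fderiv_right (m := 0) (by norm_num)).continuousAt
  refine continuousAt_pi.2 fun a => continuousAt_pi.2 fun b => ?_
  change ContinuousAt (fun A => ⟪vwFrame (F A) a,
    fderiv ℝ (farthestProj vw) A (EuclideanSpace.single b 1)⟫_ℝ / ‖vwFrame (F A) a‖ ^ 2) A₀
  refine ((hfr a).inner (hd.clm_apply continuousAt_const)).div ((hfr a).norm.pow 2) ?_
  rw [norm_vwFrame_sq (hF.orthonormal A₀ (mem_of_mem_nhds hF.mem_nhds))]
  norm_num

/-- The matrix `g₀g₀ᵗ` is orthogonal to the tangent space at itself and drops out; the two equal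
terms from `mmᵗ` cancel the squared length `2` of the frame vectors. -/
lemma tanCoord_vwFrame_outerProd_sub {g : Fin (d + 1) → EuclideanSpace ℝ (Fin (d + 1))}
    (hg : Orthonormal ℝ g) (m : EuclideanSpace ℝ (Fin (d + 1))) :
    tanCoord (vwFrame g) (outerProd m m - outerProd (g 0) (g 0)) =
      fun a => ⟪g 0, m⟫_ℝ * ⟪g a.succ, m⟫_ℝ := by
  ext a
  have h0' : ⟪g a.succ, g 0⟫_ℝ = 0 := hg.2 (Fin.succ_ne_zero a)
  rw [tanCoord, norm_vwFrame_sq hg, vwFrame, vwTangent]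
  simp only [inner_add_left, inner_sub_right, inner_outerProd, h0']
  ring

end Smoothness

/-! ### Convergence in probability without measurability -/

section InProbability

variable {Ω : Type*} [MeasurableSpace Ω] {P : Measure Ω}

/-- The filter on `ℕ × Ω` of the sets whose sections have outer probability tending to `1`, so that
convergence along it is convergence in (outer) probability. -/
def inProb (P : Measure Ω) : Filter (ℕ × Ω) where
  sets := {A | Tendsto (fun n => P {ω | (n, ω) ∉ A}) atTop (𝓝 0)}
  univ_sets := by simp
  sets_of_superset {A B} hA hAB := by
    refine tendsto_of_tendsto_of_tendsto_of_le_of_le tendsto_const_nhds hA (fun _ => zero_le)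
      fun n => measure_mono fun ω hω h => hω (hAB h)
  inter_sets {A B} hA hB := by
    have h := Tendsto.add hA hB
    rw [add_zero] at h
    refine tendsto_of_tendsto_of_tendsto_of_le_of_le tendsto_const_nhds h (fun _ => zero_le)
      fun n => (measure_mono fun ω hω => ?_).trans (measure_union_le _ _)
    simpa only [mem_inter_iff, not_and_or] using! hω

lemma eventually_inProb {p : ℕ × Ω → Prop} :
    (∀ᶠ z in inProb P, p z) ↔ Tendsto (fun n => P {ω | ¬ p (n, ω)}) atTop (𝓝 0) := Iff.rfl

lemma tendsto_inProb_iff {E : Type*} [PseudoMetricSpace E] {f : ℕ → Ω → E} {c : E} :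
    Tendsto (fun z : ℕ × Ω => f z.1 z.2) (inProb P) (𝓝 c) ↔
      TendstoInMeasure P f atTop fun _ => c := by
  rw [Metric.tendsto_nhds, tendstoInMeasure_iff_dist]
  simp only [eventually_inProb, not_lt]

lemma tendsto_fst_inProb : Tendsto Prod.fst (inProb P) (atTop : Filter ℕ) := by
  refine tendsto_atTop.2 fun b => eventually_inProb.2 ?_
  refine tendsto_const_nhds.congr' ?_
  filter_upwards [eventually_ge_atTop b] with n hn
  simp [hn]

/-- The events need not be measurable, so subadditivity replaces the formula for the measure of a
complement. -/
lemma tendsto_measure_one_of_eventually_inProb [IsProbabilityMeasure P] {p : ℕ → Ω → Prop}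
    (h : ∀ᶠ z in inProb P, p z.1 z.2) : Tendsto (fun n => P {ω | p n ω}) atTop (𝓝 1) := by
  rw [eventually_inProb] at h
  have h1 : Tendsto (fun n => 1 - P {ω | ¬ p n ω}) atTop (𝓝 (1 - 0)) :=
    ENNReal.Tendsto.sub tendsto_const_nhds h (Or.inl ENNReal.one_ne_top)
  rw [tsub_zero] at h1
  refine tendsto_of_tendsto_of_tendsto_of_le_of_le h1 tendsto_const_nhds (fun n => ?_)
    fun n => prob_le_one
  rw [tsub_le_iff_right, ← measure_univ (μ := P)]
  refine (measure_mono fun ω _ => ?_).trans (measure_union_le {ω | p n ω} {ω | ¬ p n ω})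
  exact em _

/-- A product of `o_P(1)` and `O_P(1)` is `o_P(1)`. -/
lemma tendsto_zero_of_isLittleO_of_lintegral_le {f Z : ℕ → Ω → ℝ} (hZm : ∀ n, AEMeasurable (Z n) P)
    {C : ℝ≥0∞} (hC : C ≠ ∞) (hZ : ∀ n, ∫⁻ ω, ‖Z n ω‖ₑ ∂P ≤ C)
    (h : (fun z : ℕ × Ω => f z.1 z.2) =o[inProb P] fun z : ℕ × Ω => Z z.1 z.2) :
    Tendsto (fun z : ℕ × Ω => f z.1 z.2) (inProb P) (𝓝 0) := by
  rw [Metric.tendsto_nhds]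
  intro ε hε
  rw [eventually_inProb]
  refine ENNReal.tendsto_nhds_zero.2 fun δ hδ => ?_
  wlog hδt : δ ≠ ∞ generalizing δ
  · rw [not_not] at hδt
    subst hδt
    simp
  have hδ2 : δ / 2 ≠ 0 := (ENNReal.half_pos hδ.ne').ne'
  -- Threshold for Markov's inequality: `C ≤ (δ/2) M`, and the added `1` makes `M` nonzero. Outside
  -- both exceptional sets `|f| ≤ ε/(2M) · M = ε/2`.
  set M : ℝ≥0∞ := C / (δ / 2) + 1 with hM
  have hMt : M ≠ ∞ := ENNReal.add_ne_top.2 ⟨ENNReal.div_ne_top hC hδ2, ENNReal.one_ne_top⟩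
  have hM0 : M ≠ 0 := by simp [hM]
  have hM' : 0 < M.toReal := ENNReal.toReal_pos hM0 hMt
  have hbd : ∀ n, P {ω | M ≤ ‖Z n ω‖ₑ} ≤ δ / 2 := fun n => by
    refine (meas_ge_le_lintegral_div (hZm n).enorm hM0 hMt).trans ?_
    refine ENNReal.div_le_of_le_mul ((hZ n).trans ?_)
    rw [← ENNReal.div_le_iff' hδ2 (ENNReal.div_ne_top hδt two_ne_zero)]
    exact le_self_add
  have hev := h.def (c := ε / (2 * M.toReal)) (by positivity)
  rw [eventually_inProb] at hev
  filter_upwards [ENNReal.tendsto_nhds_zero.1 hev (δ / 2) (ENNReal.half_pos hδ.ne')] with n hn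
  calc _ ≤ P ({ω | ¬ ‖f n ω‖ ≤ ε / (2 * M.toReal) * ‖Z n ω‖} ∪ {ω | M ≤ ‖Z n ω‖ₑ}) := by
        refine measure_mono fun ω hω => ?_
        simp only [mem_ofPred_eq, mem_union, dist_zero_right, not_lt] at hω ⊢
        by_contra hcon
        rw [not_or, not_not, not_le] at hcon
        have h2 : ‖Z n ω‖ < M.toReal := by
          rw [← toReal_enorm]
          exact (ENNReal.toReal_lt_toReal enorm_ne_top hMt).2 hcon.2
        have h3 : ε / (2 * M.toReal) * ‖Z n ω‖ ≤ ε / (2 * M.toReal) * M.toReal := by gcongr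
        have h4 : ε / (2 * M.toReal) * M.toReal = ε / 2 := by field_simp
        linarith [hcon.1]
    _ ≤ δ / 2 + δ / 2 := (measure_union_le _ _).trans (add_le_add hn (hbd n))
    _ = δ := ENNReal.add_halves δ

/-- The distribution function is right-continuous, and its jump at `t` is the mass of `{t}`. -/
lemma continuousAt_measure_Iic {ρ : Measure ℝ} [IsProbabilityMeasure ρ] {t : ℝ}
    (ht : ρ {t} = 0) : ContinuousAt (fun s => ρ (Iic s)) t := by
  have h1 : ContinuousAt (cdf ρ) t := by
    rw [(monotone_cdf ρ).continuousAt_iff_leftLim_eq_rightLim, StieltjesFunction.rightLim_eq]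
    have h := (cdf ρ).measure_singleton t
    rw [measure_cdf, ht, eq_comm, ENNReal.ofReal_eq_zero] at h
    exact le_antisymm ((monotone_cdf ρ).leftLim_le le_rfl) (by linarith)
  have h2 : (fun s => ρ (Iic s)) = fun s => ENNReal.ofReal (cdf ρ s) := by
    ext s
    rw [ofReal_cdf]
  rw [h2]
  exact ENNReal.continuous_ofReal.continuousAt.comp h1

/-- Convergence in law is not affected by an `o_P(1)` perturbation. -/
lemma HasAsymptoticLaw.of_tendstoInDistribution [IsProbabilityMeasure P] {Ω' : Type*}
    [MeasurableSpace Ω'] {P' : Measure Ω'} [IsProbabilityMeasure P'] {T W : ℕ → Ω → ℝ} {V : Ω' → ℝ}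
    (hW : TendstoInDistribution W atTop V (fun _ => P) P')
    (h : Tendsto (fun z : ℕ × Ω => T z.1 z.2 - W z.1 z.2) (inProb P) (𝓝 0)) :
    HasAsymptoticLaw P T (P'.map V) := by
  intro t ht
  set ρ := P'.map V with hρ
  have : IsProbabilityMeasure ρ := Measure.isProbabilityMeasure_map hW.aemeasurable_limit
  have hlim : ∀ s, ρ {s} = 0 → Tendsto (fun n => P {ω | W n ω ≤ s}) atTop (𝓝 (ρ (Iic s))) := by
    intro s hs
    have := ProbabilityMeasure.tendsto_measure_of_null_frontier_of_tendsto' hW.tendsto (E := Iic s)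
      (by simpa [frontier_Iic] using hs)
    refine this.congr fun n => ?_
    simp only [ProbabilityMeasure.coe_mk]
    rw [Measure.map_apply_of_aemeasurable (hW.forall_aemeasurable n) measurableSet_Iic]
    rfl
  -- Atoms are countable, so a continuity point `s` exists on either side of `t`, as close as
  -- needed. When `|T - W| < |t - s|`, the events `T ≤ t` and `W ≤ s` are comparable.
  have hdense : Dense {s | ρ {s} = 0} := by
    have hc := Measure.countable_meas_level_set_pos (μ := ρ) (g := id) measurable_id
    convert hc.dense_compl ℝ using 1
    ext s
    simp [pos_iff_ne_zero]
  have hcont := continuousAt_measure_Iic ht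
  have hclose : ∀ δ : ℝ, 0 < δ → Tendsto (fun n => P {ω | ¬ dist (T n ω - W n ω) 0 < δ})
      atTop (𝓝 0) := fun δ hδ => eventually_inProb.1 (Metric.tendsto_nhds.1 h δ hδ)
  refine tendsto_order.2 ⟨fun a ha => ?_, fun b hb => ?_⟩
  · obtain ⟨l, u, ⟨hl, hu⟩, hlu⟩ := mem_nhds_iff_exists_Ioo_subset.1 (hcont.eventually_const_lt ha)
    obtain ⟨s, hs, hls, hst⟩ := hdense.exists_between hl
    have hsa : a < ρ (Iic s) := hlu ⟨hls, hst.trans hu⟩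
    have hle : ∀ n, P {ω | W n ω ≤ s} - P {ω | ¬ dist (T n ω - W n ω) 0 < t - s} ≤
        P {ω | T n ω ≤ t} := fun n => by
      rw [tsub_le_iff_right]
      refine (measure_mono fun ω hω => ?_).trans (measure_union_le _ _)
      by_contra hcon
      simp only [mem_union, mem_ofPred_eq, not_or, not_not, not_le, dist_zero_right,
        Real.norm_eq_abs] at hcon hω
      linarith [hcon.1, (abs_lt.1 hcon.2).2]
    have h2 := ENNReal.Tendsto.sub (hlim s hs) (hclose (t - s) (sub_pos.2 hst))
      (Or.inl (measure_ne_top _ _))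
    rw [tsub_zero] at h2
    filter_upwards [h2.eventually_const_lt hsa] with n hn using hn.trans_le (hle n)
  · obtain ⟨l, u, ⟨hl, hu⟩, hlu⟩ := mem_nhds_iff_exists_Ioo_subset.1 (hcont.eventually_lt_const hb)
    obtain ⟨s, hs, hts, hsu⟩ := hdense.exists_between hu
    have hsb : ρ (Iic s) < b := hlu ⟨hl.trans hts, hsu⟩
    have hle : ∀ n, P {ω | T n ω ≤ t} ≤
        P {ω | W n ω ≤ s} + P {ω | ¬ dist (T n ω - W n ω) 0 < s - t} := fun n => by
      refine (measure_mono fun ω hω => ?_).trans (measure_union_le _ _)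
      by_contra hcon
      simp only [mem_union, mem_ofPred_eq, not_or, not_not, not_le, dist_zero_right,
        Real.norm_eq_abs] at hcon hω
      linarith [hcon.1, (abs_lt.1 hcon.2).1]
    have h2 := (hlim s hs).add (hclose (s - t) (sub_pos.2 hts))
    rw [add_zero] at h2
    filter_upwards [h2.eventually_lt_const hsb] with n hn using (hle n).trans_lt hn

end InProbability

/-! ### Central limit theorem in Euclidean space -/

section CentralLimit

variable {Ω : Type*} [MeasurableSpace Ω] {P : Measure Ω} [IsProbabilityMeasure P]

/-- The central limit theorem for independent, identically distributed random vectors which are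
centered with identity covariance. -/
lemma tendstoInDistribution_stdGaussian {E : Type*} [NormedAddCommGroup E] [InnerProductSpace ℝ E]
    [FiniteDimensional ℝ E] [MeasurableSpace E] [BorelSpace E] {ξ : ℕ → Ω → E}
    (hm : ∀ n, Measurable (ξ n)) (hindep : iIndepFun ξ P)
    (hident : ∀ i, IdentDistrib (ξ i) (ξ 0) P P)
    (hL : ∀ t, MemLp (fun ω => ⟪ξ 0 ω, t⟫_ℝ) 2 P) (h0 : ∀ t, ∫ ω, ⟪ξ 0 ω, t⟫_ℝ ∂P = 0)
    (h2 : ∀ t, ∫ ω, ⟪ξ 0 ω, t⟫_ℝ ^ 2 ∂P = ‖t‖ ^ 2) :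
    TendstoInDistribution (fun (n : ℕ) ω => (√n)⁻¹ • ∑ k ∈ Finset.range n, ξ k ω) atTop id
      (fun _ => P) (stdGaussian E) := by
  have hsm : ∀ n : ℕ, Measurable fun ω => (√n)⁻¹ • ∑ k ∈ Finset.range n, ξ k ω := fun n =>
    (Finset.measurable_fun_sum _ fun k _ => hm k).const_smul _
  refine ⟨fun n => (hsm n).aemeasurable, aemeasurable_id,
    ProbabilityMeasure.tendsto_iff_tendsto_charFun.2 fun t => ?_⟩
  have hin : Measurable fun x : E => ⟪x, t⟫_ℝ := by fun_prop
  have hmean : P[fun ω => ⟪ξ 0 ω, t⟫_ℝ] = 0 := h0 t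
  have hvar : Var[fun ω => ⟪ξ 0 ω, t⟫_ℝ; P] = ‖t‖ ^ 2 := by
    rw [variance_eq_integral (hL t).aemeasurable, hmean]
    simpa using h2 t
  have hclt := tendstoInDistribution_inv_sqrt_mul_sum_sub (P := P)
    (X := fun k ω => ⟪ξ k ω, t⟫_ℝ) (Y := id) (P' := gaussianReal 0 (‖t‖ ^ 2).toNNReal)
    ⟨aemeasurable_id, by rw [hvar, Measure.map_id]⟩ (hL t) (hindep.comp (fun _ x => ⟪x, t⟫_ℝ)
      fun _ => hin) (fun i => (hident i).comp hin)
  -- Cramér–Wold: the characteristic function of the vector at `t` is that of its product with `t`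
  -- at `1`, so the scalar theorem applies.
  have h := ProbabilityMeasure.tendsto_iff_tendsto_charFun.1 hclt.tendsto 1
  simp only [ProbabilityMeasure.coe_mk, Measure.map_id, charFun_gaussianReal,
    charFun_stdGaussian] at h ⊢
  have e : ∀ n : ℕ, charFun (P.map fun ω => (√n)⁻¹ • ∑ k ∈ Finset.range n, ξ k ω) t =
      charFun (P.map fun ω => (√n)⁻¹ * (∑ k ∈ Finset.range n, ⟪ξ k ω, t⟫_ℝ -
        n * P[fun ω => ⟪ξ 0 ω, t⟫_ℝ])) 1 := by
    intro n
    rw [charFun_apply, charFun_apply, integral_map (hsm n).aemeasurable (by fun_prop),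
      integral_map (hclt.forall_aemeasurable n) (by fun_prop)]
    simp [hmean, inner_smul_left, sum_inner]
  refine (h.congr fun n => (e n).symm).trans (le_of_eq ?_)
  congr 2
  simp
  ring

lemma map_norm_sq_stdGaussian (d : ℕ) :
    (stdGaussian (EuclideanSpace ℝ (Fin d))).map (fun x => ‖x‖ ^ 2) = chiSq d := by
  rw [← map_pi_eq_stdGaussian, Measure.map_map (by fun_prop) (by fun_prop), chiSq]
  congr 1
  ext z
  simp [EuclideanSpace.real_norm_sq_eq]

/-- The normalized sums of bounded centered independent random variables are bounded in `L²`. -/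
lemma integral_inv_sqrt_mul_sum_sq_le {X : ℕ → Ω → ℝ} (hm : ∀ n, Measurable (X n))
    (hindep : iIndepFun X P) (h0 : ∀ k, ∫ ω, X k ω ∂P = 0) {C : ℝ} (hC : ∀ k ω, |X k ω| ≤ C)
    (n : ℕ) : ∫ ω, ((√n)⁻¹ * ∑ k ∈ Finset.range n, X k ω) ^ 2 ∂P ≤ C ^ 2 := by
  have hL : ∀ k, MemLp (X k) 2 P := fun k =>
    MemLp.of_bound (hm k).aestronglyMeasurable C (ae_of_all _ (hC k))
  have hsum : ∫ ω, (∑ k ∈ Finset.range n, X k ω) ^ 2 ∂P ≤ n * C ^ 2 := by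
    have hms : Measurable fun ω => ∑ k ∈ Finset.range n, X k ω :=
      Finset.measurable_fun_sum _ fun k _ => hm k
    have h := IndepFun.variance_sum (s := Finset.range n) (fun k _ => hL k)
      (fun i _ k _ hik => hindep.indepFun hik)
    have hz : ∫ ω, ∑ k ∈ Finset.range n, X k ω ∂P = 0 := by
      rw [integral_finsetSum _ fun k _ => (hL k).integrable one_le_two]
      simp [h0]
    have hf : (∑ k ∈ Finset.range n, X k) = fun ω => ∑ k ∈ Finset.range n, X k ω := by
      ext ω
      simp
    rw [hf, variance_eq_integral hms.aemeasurable, hz] at h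
    simp only [sub_zero] at h
    rw [h]
    refine (Finset.sum_le_card_nsmul _ _ (C ^ 2) fun k _ => ?_).trans (by simp)
    rw [variance_eq_integral (hm k).aemeasurable, h0 k]
    have hb : ∀ ω, (X k ω - 0) ^ 2 ≤ C ^ 2 := fun ω => by
      rw [sub_zero, ← sq_abs]
      exact pow_le_pow_left₀ (abs_nonneg _) (hC k ω) 2
    have := integral_mono_of_nonneg (μ := P) (ae_of_all _ fun ω => sq_nonneg (X k ω - 0))
      (integrable_const (C ^ 2)) (ae_of_all _ hb)
    simpa using this
  simp_rw [mul_pow]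
  rw [integral_const_mul, inv_pow, Real.sq_sqrt (Nat.cast_nonneg n)]
  -- For `n = 0` the normalized sum is `0`, so the bound still holds.
  rcases Nat.eq_zero_or_pos n with rfl | hn
  · simpa using sq_nonneg C
  · have : (0 : ℝ) < n := by exact_mod_cast hn
    rw [inv_mul_le_iff₀ this]
    exact hsum

/-- The normalized sums of bounded centered independent random vectors are bounded in `L²`. -/
lemma exists_lintegral_norm_sq_le {κ : Type*} [Fintype κ] {ξ : ℕ → Ω → EuclideanSpace ℝ κ}
    (hm : ∀ n, Measurable (ξ n)) (hindep : iIndepFun ξ P) (h0 : ∀ k p, ∫ ω, ξ k ω p ∂P = 0)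
    {C : ℝ} (hC : ∀ k ω, ‖ξ k ω‖ ≤ C) : ∃ D : ℝ≥0∞, D ≠ ∞ ∧ ∀ n : ℕ,
      ∫⁻ ω, ‖‖(√n)⁻¹ • ∑ k ∈ Finset.range n, ξ k ω‖ ^ 2‖ₑ ∂P ≤ D := by
  have hmp : ∀ k p, Measurable fun ω => ξ k ω p := fun k p => by
    have := hm k
    fun_prop
  have hCp : ∀ k p ω, |ξ k ω p| ≤ C := fun k p ω => (PiLp.norm_apply_le (ξ k ω) p).trans (hC k ω)
  refine ⟨ENNReal.ofReal (∑ _ : κ, C ^ 2), ENNReal.ofReal_ne_top, fun n => ?_⟩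
  have he : ∀ ω, ‖(√n)⁻¹ • ∑ k ∈ Finset.range n, ξ k ω‖ ^ 2 =
      ∑ p, ((√n)⁻¹ * ∑ k ∈ Finset.range n, ξ k ω p) ^ 2 := fun ω => by
    rw [EuclideanSpace.real_norm_sq_eq]
    simp
  have hint : ∀ p, Integrable (fun ω => ((√n)⁻¹ * ∑ k ∈ Finset.range n, ξ k ω p) ^ 2) P := fun p => by
    have h1 : ∀ k, MemLp (fun ω => ξ k ω p) 2 P := fun k =>
      MemLp.of_bound (hmp k p).aestronglyMeasurable C (ae_of_all _ (hCp k p))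
    have h2 : MemLp (fun ω => ∑ k ∈ Finset.range n, ξ k ω p) 2 P := memLp_finsetSum _ fun k _ => h1 k
    exact (h2.const_mul _).integrable_sq
  simp_rw [he]
  rw [lintegral_congr fun ω => Real.enorm_of_nonneg (Finset.sum_nonneg fun p _ => sq_nonneg _),
    ← ofReal_integral_eq_lintegral_ofReal (integrable_finsetSum _ fun p _ => hint p)
    (ae_of_all _ fun ω => Finset.sum_nonneg fun p _ => sq_nonneg _),
    integral_finsetSum _ fun p _ => hint p]
  refine ENNReal.ofReal_le_ofReal (Finset.sum_le_sum fun p _ => ?_)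
  exact integral_inv_sqrt_mul_sum_sq_le (fun k => hmp k p)
    (hindep.comp (fun _ x => x p) fun _ => by fun_prop) (fun k => h0 k p) (fun k => hCp k p) n

end CentralLimit

/-! ### Inverse square roots, covariance matrices and the deterministic identity -/

section InverseSquareRoot

variable {ι : Type*} [Fintype ι] [DecidableEq ι] {S : Matrix ι ι ℝ}

lemma transpose_invSqrt (S : Matrix ι ι ℝ) : (invSqrt S)ᵀ = invSqrt S := by
  have h : IsSelfAdjoint (invSqrt S) := cfc_predicate _ S
  rw [← Matrix.conjTranspose_eq_transpose_of_trivial]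
  exact h

/-- Positivity of the spectrum makes `(√t)⁻¹` continuous on it and gives `(√t)⁻¹ (√t)⁻¹ t = 1`
there; the functional calculus transfers this to `S`. -/
lemma invSqrt_mul_self (hS : S.PosDef) : invSqrt S * invSqrt S = S⁻¹ := by
  have hsa : IsSelfAdjoint S := hS.isHermitian
  have hpos : ∀ t ∈ spectrum ℝ S, 0 < t := by
    intro t ht
    rw [hS.isHermitian.spectrum_real_eq_range_eigenvalues] at ht
    obtain ⟨i, rfl⟩ := ht
    exact hS.eigenvalues_pos i
  have hc : ContinuousOn (fun t : ℝ => (√t)⁻¹) (spectrum ℝ S) :=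
    Real.continuous_sqrt.continuousOn.inv₀ fun t ht => (Real.sqrt_pos.2 (hpos t ht)).ne'
  symm
  apply Matrix.inv_eq_left_inv
  have hid : cfc (fun t : ℝ => t) S = S := cfc_id' ℝ S
  calc invSqrt S * invSqrt S * S
      = cfc (fun t : ℝ => (√t)⁻¹ * (√t)⁻¹ * t) S := by
        rw [cfc_mul (fun t => (√t)⁻¹ * (√t)⁻¹) (fun t => t) S (hc.mul hc) continuousOn_id,
          cfc_mul _ _ S hc hc, hid, invSqrt]
    _ = cfc (fun _ : ℝ => (1 : ℝ)) S := by
        refine cfc_congr fun t ht => ?_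
        have := hpos t ht
        change (√t)⁻¹ * (√t)⁻¹ * t = 1
        rw [← mul_inv, Real.mul_self_sqrt this.le, inv_mul_cancel₀ this.ne']
    _ = 1 := cfc_const_one ℝ S

lemma norm_sq_invSqrt_mulVec (hS : S.PosDef) (v : ι → ℝ) :
    ‖WithLp.toLp 2 (invSqrt S *ᵥ v)‖ ^ 2 = v ⬝ᵥ (S⁻¹ *ᵥ v) := by
  rw [← invSqrt_mul_self hS, ← Matrix.mulVec_mulVec, Matrix.dotProduct_mulVec,
    ← Matrix.mulVec_transpose, transpose_invSqrt, EuclideanSpace.real_norm_sq_eq]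
  simp [dotProduct, sq]

end InverseSquareRoot

section Covariance

variable {M κ : Type*} [Fintype κ] [MeasurableSpace M]
  {j : M → EuclideanSpace ℝ κ} {Q : Measure M}

lemma integrable_coord_mul_coord [IsFiniteMeasure Q] (hm : Measurable j) {C : ℝ}
    (hC : ∀ x, ‖j x‖ ≤ C) (m : EuclideanSpace ℝ κ) (p q : κ) :
    Integrable (fun x => (j x p - m p) * (j x q - m q)) Q := by
  have hb : ∀ x r, |j x r - m r| ≤ C + ‖m‖ := fun x r =>
    (abs_sub _ _).trans (add_le_add ((PiLp.norm_apply_le (j x) r).trans (hC x))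
      (PiLp.norm_apply_le m r))
  refine Integrable.of_bound (Measurable.aestronglyMeasurable (by fun_prop)) ((C + ‖m‖) * (C + ‖m‖))
    (ae_of_all _ fun x => ?_)
  rw [norm_mul]
  exact mul_le_mul (hb x p) (hb x q) (norm_nonneg _) ((abs_nonneg _).trans (hb x p))

/-- The quadratic form of the covariance matrix. -/
lemma dotProduct_extCov_mulVec [IsFiniteMeasure Q] (hm : Measurable j) {C : ℝ}
    (hC : ∀ x, ‖j x‖ ≤ C) (u : κ → ℝ) :
    u ⬝ᵥ (extCov j Q *ᵥ u) = ∫ x, (u ⬝ᵥ (j x - extMean j Q).ofLp) ^ 2 ∂Q := by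
  have h := integrable_coord_mul_coord (Q := Q) hm hC (extMean j Q)
  have e : ∀ x, (u ⬝ᵥ (j x - extMean j Q).ofLp) ^ 2 = ∑ p, ∑ q,
      u p * ((j x p - extMean j Q p) * (j x q - extMean j Q q) * u q) := fun x => by
    simp only [dotProduct, sq, Finset.sum_mul_sum, PiLp.sub_apply]
    exact Finset.sum_congr rfl fun p _ => Finset.sum_congr rfl fun q _ => by ring
  simp_rw [e]
  rw [integral_finsetSum _ fun p _ => integrable_finsetSum _ fun q _ =>
    ((h p q).mul_const _).const_mul _]
  simp only [dotProduct, Matrix.mulVec, Finset.mul_sum]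
  refine Finset.sum_congr rfl fun p _ => ?_
  rw [integral_finsetSum _ fun q _ => ((h p q).mul_const _).const_mul _]
  refine Finset.sum_congr rfl fun q _ => ?_
  rw [integral_const_mul, integral_mul_const]
  rfl

lemma posSemidef_extCov [IsFiniteMeasure Q] (hm : Measurable j) {C : ℝ}
    (hC : ∀ x, ‖j x‖ ≤ C) : (extCov j Q).PosSemidef := by
  refine Matrix.PosSemidef.of_dotProduct_mulVec_nonneg ?_ fun u => ?_
  · ext p q
    simp only [extCov, Matrix.conjTranspose_apply, Matrix.of_apply, star_trivial]
    exact integral_congr_ae (ae_of_all _ fun x => mul_comm _ _)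
  · rw [star_trivial, dotProduct_extCov_mulVec hm hC]
    exact integral_nonneg fun x => sq_nonneg _

/-- A matrix `LΣLᵗ` is always positive semidefinite, so a nonzero determinant is enough. This serves
both `Q` and the empirical distribution. -/
lemma posDef_anticov [DecidableEq κ] {ι : Type*} [Fintype ι] [DecidableEq ι] [IsFiniteMeasure Q]
    (hm : Measurable j) {C : ℝ} (hC : ∀ x, ‖j x‖ ≤ C) {e : ι → EuclideanSpace ℝ κ}
    (hdet : (anticov j Q e).det ≠ 0) : (anticov j Q e).PosDef := by
  have h := (posSemidef_extCov (Q := Q) hm hC).mul_mul_conjTranspose_same (dFarthestProj j Q e)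
  rw [Matrix.conjTranspose_eq_transpose_of_trivial] at h
  refine h.posDef_iff_isUnit.2 ?_
  exact (Matrix.isUnit_iff_isUnit_det _).2 hdet.isUnit

/-- For `n = 0` the weight is `∞`, but it multiplies the zero measure. -/
lemma isFiniteMeasure_empirical {Ω : Type*} (Y : ℕ → Ω → M) (n : ℕ) (ω : Ω) :
    IsFiniteMeasure (empirical Y n ω) := by
  rcases Nat.eq_zero_or_pos n with rfl | hn
  · simp only [empirical, Finset.range_zero, Finset.sum_empty, smul_zero]
    infer_instance
  · refine ⟨?_⟩
    simp only [empirical, Measure.smul_apply, smul_eq_mul]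
    refine ENNReal.mul_lt_top (ENNReal.inv_lt_top.2 (by simpa using hn)) (measure_lt_top _ _)

lemma integral_empirical {Ω E : Type*} [NormedAddCommGroup E] [NormedSpace ℝ E] [CompleteSpace E]
    [SecondCountableTopology E] [MeasurableSpace E] [BorelSpace E]
    {f : M → E} (hf : Measurable f) (Y : ℕ → Ω → M)
    (n : ℕ) (ω : Ω) : ∫ x, f x ∂(empirical Y n ω) = (n : ℝ)⁻¹ • ∑ r ∈ Finset.range n, f (Y r ω) := by
  rw [empirical, integral_smul_measure, integral_finsetSum_measure]
  · simp [integral_dirac' _ _ hf.stronglyMeasurable]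
  · intro r _
    exact integrable_dirac' hf.stronglyMeasurable enorm_lt_top

end Covariance

section Statistics

variable {d : ℕ} {Ω : Type*} {Q : Measure (RealProj (d + 1))}
  {ν : Fin (d + 1) → EuclideanSpace ℝ (Fin (d + 1))} {Y : ℕ → Ω → RealProj (d + 1)}
  {U : Set (EuclideanSpace ℝ (Fin (d + 1) × Fin (d + 1)))}
  {F : EuclideanSpace ℝ (Fin (d + 1) × Fin (d + 1)) →
      Fin (d + 1) → EuclideanSpace ℝ (Fin (d + 1))}

/-- Separates a matrix depending only on the sample mean from the empirical covariance, so that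
their limits can be taken independently. -/
lemma sampleAnticov_eq (n : ℕ) (ω : Ω) : sampleAnticov Y F n ω =
    frameDeriv F (sampleMean Y n ω) * extCov vw (empirical Y n ω) *
      (frameDeriv F (sampleMean Y n ω))ᵀ := rfl

lemma statT_eq (n : ℕ) (ω : Ω) (hdet : (sampleAnticov Y F n ω).det ≠ 0) :
    statT Q ν Y F n ω = n * (tanCoord (vwFrame ν)
      (farthestProj vw (sampleMean Y n ω) - farthestProj vw (extMean vw Q)) ⬝ᵥ
      ((sampleAnticov Y F n ω)⁻¹ *ᵥ tanCoord (vwFrame ν)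
      (farthestProj vw (sampleMean Y n ω) - farthestProj vw (extMean vw Q)))) := by
  have := isFiniteMeasure_empirical Y n ω
  rw [statT, norm_sq_invSqrt_mulVec]
  exact posDef_anticov measurable_vw (fun x => (norm_vw x).le) hdet

/-- The two statistics differ by the squared cosine of the angle between the antimeans. -/
lemma statT_eq_mul_quadT (hν : Orthonormal ℝ ν) (hF : IsAdaptedFrame U (extMean vw Q) F)
    (hFν : F (extMean vw Q) = ν) (n : ℕ) (ω : Ω) (hU : sampleMean Y n ω ∈ U)
    (hdet : (sampleAnticov Y F n ω).det ≠ 0) :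
    statT Q ν Y F n ω = ⟪ν 0, F (sampleMean Y n ω) 0⟫_ℝ ^ 2 * quadT ν Y F n ω := by
  have h0 := mem_of_mem_nhds hF.mem_nhds
  rw [statT_eq n ω hdet, ← hF.proj _ hU, ← hF.proj _ h0, hFν, tanCoord_vwFrame_outerProd_sub hν,
    quadT]
  set m := F (sampleMean Y n ω) 0
  have h1 : (fun a : Fin d => ⟪ν 0, m⟫_ℝ * ⟪ν a.succ, m⟫_ℝ) =
      ⟪ν 0, m⟫_ℝ • ((colsTail ν)ᵀ *ᵥ m.ofLp) := by
    ext a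
    simp [Matrix.mulVec, dotProduct, colsTail, PiLp.inner_apply, mul_comm]
  rw [h1, Matrix.mulVec_smul, smul_dotProduct, dotProduct_smul, ← Matrix.mulVec_mulVec,
    ← Matrix.mulVec_mulVec, Matrix.dotProduct_mulVec m.ofLp, ← Matrix.mulVec_transpose]
  simp only [smul_eq_mul]
  ring

end Statistics

/-! ### Perturbation of quadratic forms in `o` and `O` notation. -/

section QuadraticForms

lemma isBigO_dotProduct_mulVec {α ι : Type*} [Fintype ι] {l : Filter α} {w : α → ι → ℝ}
    {g : α → ℝ} (hw : ∀ a, (fun z => w z a) =O[l] g) (N : Matrix ι ι ℝ) :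
    (fun z => w z ⬝ᵥ (N *ᵥ w z)) =O[l] fun z => g z ^ 2 := by
  simp only [dotProduct, Matrix.mulVec, sq]
  exact Asymptotics.IsBigO.fun_sum fun a _ => (hw a).mul
    (Asymptotics.IsBigO.fun_sum fun b _ => (hw b).const_mul_left _)

lemma isLittleO_dotProduct_mulVec_sub {α ι : Type*} [Fintype ι] {l : Filter α} {v w : α → ι → ℝ}
    {M : α → Matrix ι ι ℝ} {N : Matrix ι ι ℝ} {g : α → ℝ} (hM : Tendsto M l (𝓝 N))
    (hw : ∀ a, (fun z => w z a) =O[l] g) (hr : ∀ a, (fun z => v z a - w z a) =o[l] g) :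
    (fun z => v z ⬝ᵥ (M z *ᵥ v z) - w z ⬝ᵥ (N *ᵥ w z)) =o[l] fun z => g z ^ 2 := by
  have hv : ∀ a, (fun z => v z a) =O[l] g := fun a => by
    simpa using (hr a).isBigO.add (hw a)
  have hMab : ∀ a b, (fun z => M z a b - N a b) =o[l] fun _ => (1 : ℝ) := fun a b => by
    rw [Asymptotics.isLittleO_one_iff]
    have := (tendsto_pi_nhds.1 (tendsto_pi_nhds.1 hM a) b).sub_const (N a b)
    rwa [sub_self] at this
  -- Telescoping: each summand has exactly one small factor, either `M - N = o(1)` or `v - w =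
  -- o(g)`, and the remaining factors are bounded or `O(g)`.
  have e : (fun z => v z ⬝ᵥ (M z *ᵥ v z) - w z ⬝ᵥ (N *ᵥ w z)) = fun z => ∑ a, ∑ b,
      ((M z a b - N a b) * (v z a * v z b) +
        N a b * ((v z a - w z a) * v z b + w z a * (v z b - w z b))) := by
    ext z
    simp only [dotProduct, Matrix.mulVec, Finset.mul_sum, ← Finset.sum_sub_distrib]
    exact Finset.sum_congr rfl fun a _ => Finset.sum_congr rfl fun b _ => by ring
  rw [e]
  refine Asymptotics.IsLittleO.fun_sum fun a _ => Asymptotics.IsLittleO.fun_sum fun b _ => ?_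
  have h1 : (fun z => (M z a b - N a b) * (v z a * v z b)) =o[l] fun z => g z ^ 2 := by
    simpa [sq] using (hMab a b).mul_isBigO ((hv a).mul (hv b))
  have h2 : (fun z => (v z a - w z a) * v z b) =o[l] fun z => g z ^ 2 := by
    simpa only [sq] using (hr a).mul_isBigO (hv b)
  have h3 : (fun z => w z a * (v z b - w z b)) =o[l] fun z => g z ^ 2 := by
    simpa only [sq] using (hw a).mul_isLittleO (hr b)
  exact h1.add ((h2.add h3).const_mul_left _)

/-- The coordinates of the tangential component, as a linear map. -/
def tanCoordL {ι κ : Type*} [Fintype κ] (e : ι → EuclideanSpace ℝ κ) (a : ι) :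
    EuclideanSpace ℝ κ →L[ℝ] ℝ := (‖e a‖ ^ 2)⁻¹ • innerSL ℝ (e a)

lemma tanCoordL_apply {ι κ : Type*} [Fintype κ] (e : ι → EuclideanSpace ℝ κ) (a : ι)
    (v : EuclideanSpace ℝ κ) : tanCoordL e a v = tanCoord e v a := by
  simp [tanCoordL, tanCoord, div_eq_inv_mul]

end QuadraticForms

/-! ### Laws of large numbers for the empirical mean and covariance. -/

section LargeSample

variable {M : Type*} [MeasurableSpace M] {Ω : Type*} [MeasurableSpace Ω] {P : Measure Ω}
  [IsProbabilityMeasure P] {Q : Measure M} {Y : ℕ → Ω → M}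

/-- The weak law of large numbers for the empirical distribution. -/
lemma tendsto_integral_empirical {E : Type*} [NormedAddCommGroup E] [NormedSpace ℝ E]
    [CompleteSpace E] [SecondCountableTopology E] [MeasurableSpace E] [BorelSpace E]
    (hYm : ∀ r, Measurable (Y r)) (hYlaw : ∀ r, P.map (Y r) = Q) (hYind : iIndepFun Y P)
    {f : M → E} (hf : Measurable f) {C : ℝ} (hC : ∀ x, ‖f x‖ ≤ C) :
    Tendsto (fun z : ℕ × Ω => ∫ x, f x ∂(empirical Y z.1 z.2)) (inProb P) (𝓝 (∫ x, f x ∂Q)) := by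
  rw [tendsto_inProb_iff (f := fun n ω => ∫ x, f x ∂(empirical Y n ω))]
  simp_rw [integral_empirical hf]
  have hfm : ∀ r, Measurable fun ω => f (Y r ω) := fun r => hf.comp (hYm r)
  refine tendstoInMeasure_of_tendsto_ae (fun n => Measurable.aestronglyMeasurable
    ((Finset.measurable_fun_sum _ fun r _ => hfm r).const_smul _)) ?_
  have hint : Integrable (fun ω => f (Y 0 ω)) P :=
    Integrable.of_bound (hfm 0).aestronglyMeasurable C (ae_of_all _ fun ω => hC _)
  have h := strong_law_ae (μ := P) (fun r ω => f (Y r ω)) hint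
    (fun i k hik => (hYind.indepFun hik).comp hf hf)
    (fun i => IdentDistrib.comp ⟨(hYm i).aemeasurable, (hYm 0).aemeasurable,
      by rw [hYlaw, hYlaw]⟩ hf)
  have he : ∫ x, f x ∂Q = ∫ ω, f (Y 0 ω) ∂P := by
    rw [← hYlaw 0, integral_map (hYm 0).aemeasurable hf.aestronglyMeasurable]
  rwa [he]

variable {κ : Type*} [Fintype κ] {j : M → EuclideanSpace ℝ κ}

lemma extMean_apply [IsFiniteMeasure Q] (hm : Measurable j) {C : ℝ} (hC : ∀ x, ‖j x‖ ≤ C) (p : κ) :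
    extMean j Q p = ∫ x, j x p ∂Q :=
  ((EuclideanSpace.proj (𝕜 := ℝ) p).integral_comp_comm
    (Integrable.of_bound hm.aestronglyMeasurable C (ae_of_all _ hC))).symm

/-- Removes the centering, which depends on the measure, so that the law of large numbers applies to
fixed integrands. Total mass `1` is needed for the constant terms. -/
lemma extCov_apply [IsProbabilityMeasure Q] (hm : Measurable j) {C : ℝ} (hC : ∀ x, ‖j x‖ ≤ C)
    (p q : κ) : extCov j Q p q = ∫ x, j x p * j x q ∂Q - extMean j Q p * extMean j Q q := by
  have h1 : ∀ p, Integrable (fun x => j x p) Q := fun p =>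
    (EuclideanSpace.proj (𝕜 := ℝ) p).integrable_comp
      (Integrable.of_bound hm.aestronglyMeasurable C (ae_of_all _ hC))
  have h2 : Integrable (fun x => j x p * j x q) Q := by
    simpa using integrable_coord_mul_coord (Q := Q) hm hC 0 p q
  have e : ∀ x, (j x p - extMean j Q p) * (j x q - extMean j Q q) =
      j x p * j x q - extMean j Q q * j x p - extMean j Q p * j x q +
        extMean j Q p * extMean j Q q := fun x => by ring
  simp only [extCov, Matrix.of_apply, e]
  have h3 : Integrable (fun x => j x p * j x q - extMean j Q q * j x p) Q :=
    h2.sub ((h1 p).const_mul _)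
  have h4 : Integrable (fun x => j x p * j x q - extMean j Q q * j x p - extMean j Q p * j x q) Q :=
    h3.sub ((h1 q).const_mul _)
  rw [integral_add h4 (integrable_const _), integral_sub h3 ((h1 q).const_mul _),
    integral_sub h2 ((h1 p).const_mul _), integral_const_mul, integral_const_mul,
    ← extMean_apply hm hC, ← extMean_apply hm hC]
  simp
  ring

lemma isProbabilityMeasure_empirical {Ω : Type*} (Y : ℕ → Ω → M) {n : ℕ} (hn : n ≠ 0) (ω : Ω) :
    IsProbabilityMeasure (empirical Y n ω) := by
  refine ⟨?_⟩
  simp only [empirical, Measure.smul_apply, smul_eq_mul, Measure.finsetSum_apply, measure_univ,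
    Finset.sum_const, Finset.card_range, nsmul_eq_mul, mul_one]
  exact ENNReal.inv_mul_cancel (by exact_mod_cast hn) (ENNReal.natCast_ne_top n)

lemma tendsto_extCov_empirical [IsProbabilityMeasure Q]
    (hYm : ∀ r, Measurable (Y r)) (hYlaw : ∀ r, P.map (Y r) = Q) (hYind : iIndepFun Y P)
    (hm : Measurable j) {C : ℝ} (hC : ∀ x, ‖j x‖ ≤ C) :
    Tendsto (fun z : ℕ × Ω => extCov j (empirical Y z.1 z.2)) (inProb P) (𝓝 (extCov j Q)) := by
  refine tendsto_pi_nhds.2 fun p => tendsto_pi_nhds.2 fun q => ?_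
  rw [extCov_apply hm hC]
  have hK : Tendsto (fun z : ℕ × Ω => extMean j (empirical Y z.1 z.2)) (inProb P)
      (𝓝 (extMean j Q)) := tendsto_integral_empirical hYm hYlaw hYind hm hC
  have hKp : ∀ p, Tendsto (fun z : ℕ × Ω => extMean j (empirical Y z.1 z.2) p) (inProb P)
      (𝓝 (extMean j Q p)) := fun p =>
    ((EuclideanSpace.proj (𝕜 := ℝ) p).continuous.tendsto _).comp hK
  have hb : ∀ x r, |j x r| ≤ C := fun x r => (PiLp.norm_apply_le (j x) r).trans (hC x)
  have h2 := tendsto_integral_empirical (f := fun x => j x p * j x q) (C := C * C) hYm hYlaw hYind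
    (by fun_prop) fun x => by
      rw [norm_mul]
      exact mul_le_mul (hb x p) (hb x q) (norm_nonneg _) ((abs_nonneg _).trans (hb x p))
  refine (h2.sub ((hKp p).mul (hKp q))).congr' ?_
  -- The empirical distribution has mass `1` only for `n ≠ 0`.
  filter_upwards [tendsto_fst_inProb.eventually (eventually_ne_atTop 0)] with z hz
  have := isProbabilityMeasure_empirical Y hz z.2
  rw [extCov_apply hm hC]

end LargeSample

/-! ### Consistency of the sample anticovariance and the limit law of the linearized statistic. -/

section Asymptotics

variable {d : ℕ} {Ω : Type*} [MeasurableSpace Ω] {P : Measure Ω} [IsProbabilityMeasure P]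
  {Q : Measure (RealProj (d + 1))} {Y : ℕ → Ω → RealProj (d + 1)}
  {U : Set (EuclideanSpace ℝ (Fin (d + 1) × Fin (d + 1)))}
  {F : EuclideanSpace ℝ (Fin (d + 1) × Fin (d + 1)) →
      Fin (d + 1) → EuclideanSpace ℝ (Fin (d + 1))}

lemma tendsto_sampleMean (hYm : ∀ r, Measurable (Y r)) (hYlaw : ∀ r, P.map (Y r) = Q)
    (hYind : iIndepFun Y P) :
    Tendsto (fun z : ℕ × Ω => sampleMean Y z.1 z.2) (inProb P) (𝓝 (extMean vw Q)) :=
  tendsto_integral_empirical hYm hYlaw hYind measurable_vw fun x => (norm_vw x).le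

lemma tendsto_sampleAnticov [IsProbabilityMeasure Q] (hYm : ∀ r, Measurable (Y r))
    (hYlaw : ∀ r, P.map (Y r) = Q)
    (hYind : iIndepFun Y P) (hF : IsAdaptedFrame U (extMean vw Q) F) :
    Tendsto (fun z : ℕ × Ω => sampleAnticov Y F z.1 z.2) (inProb P)
      (𝓝 (anticov vw Q (vwFrame (F (extMean vw Q))))) := by
  have hD := hF.continuousAt_frameDeriv.tendsto.comp (tendsto_sampleMean hYm hYlaw hYind)
  have hC := tendsto_extCov_empirical hYm hYlaw hYind measurable_vw fun x => (norm_vw x).le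
  have hcont : Continuous fun z : Matrix (Fin d) (Fin (d + 1) × Fin (d + 1)) ℝ ×
      Matrix (Fin (d + 1) × Fin (d + 1)) (Fin (d + 1) × Fin (d + 1)) ℝ => z.1 * z.2 * z.1ᵀ :=
    (continuous_fst.matrix_mul continuous_snd).matrix_mul continuous_fst.matrix_transpose
  have h := (hcont.tendsto (frameDeriv F (extMean vw Q), extCov vw Q)).comp (hD.prodMk_nhds hC)
  have e : anticov vw Q (vwFrame (F (extMean vw Q))) = frameDeriv F (extMean vw Q) *
    extCov vw Q * (frameDeriv F (extMean vw Q))ᵀ := rfl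
  simp only [sampleAnticov_eq, e]
  exact h

/-- The deviation `√n (K_n - μ)` of the sample mean. -/
def scaledDev (Q : Measure (RealProj (d + 1))) (Y : ℕ → Ω → RealProj (d + 1)) (n : ℕ) (ω : Ω) :
    EuclideanSpace ℝ (Fin (d + 1) × Fin (d + 1)) :=
  (√n)⁻¹ • ∑ k ∈ Finset.range n, (vw (Y k ω) - extMean vw Q)

/-- The sum form feeds the central limit theorem and the moment bound; this form feeds the delta
method. -/
lemma scaledDev_eq {Ω : Type*} {Y : ℕ → Ω → RealProj (d + 1)} (n : ℕ) (ω : Ω) :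
    scaledDev Q Y n ω = √n • (sampleMean Y n ω - extMean vw Q) := by
  rcases Nat.eq_zero_or_pos n with rfl | hn
  · simp [scaledDev]
  have hn' : (0 : ℝ) < n := by exact_mod_cast hn
  have h : (√n)⁻¹ * n = √n := by
    rw [inv_mul_eq_div, Real.div_sqrt]
  have h2 : √n * (n : ℝ)⁻¹ = (√n)⁻¹ := by
    nth_rw 1 [← h]
    field_simp
  have hK : sampleMean Y n ω = (n : ℝ)⁻¹ • ∑ r ∈ Finset.range n, vw (Y r ω) :=
    integral_empirical measurable_vw Y n ω
  rw [scaledDev, hK, Finset.sum_sub_distrib,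
    smul_sub, smul_sub, smul_smul, h2, Finset.sum_const, Finset.card_range, ← Nat.cast_smul_eq_nsmul ℝ,
    smul_smul, h]

lemma measurable_scaledDev (hYm : ∀ r, Measurable (Y r)) (n : ℕ) :
    Measurable (scaledDev Q Y n) := by
  have h : Measurable fun ω => ∑ k ∈ Finset.range n, (vw (Y k ω) - extMean vw Q) :=
    Finset.measurable_fun_sum _ fun k _ => (measurable_vw.comp (hYm k)).sub_const _
  exact h.const_smul (√n)⁻¹

lemma dFarthestProj_mulVec (e : Fin d → EuclideanSpace ℝ (Fin (d + 1) × Fin (d + 1)))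
    (x : EuclideanSpace ℝ (Fin (d + 1) × Fin (d + 1))) (a : Fin d) :
    (dFarthestProj vw Q e *ᵥ x.ofLp) a =
      tanCoordL e a (fderiv ℝ (farthestProj vw) (extMean vw Q) x) := by
  have hx : x = ∑ b, x b • EuclideanSpace.single b (1 : ℝ) := by
    ext b
    simp [Finset.sum_apply, Pi.single_apply]
  conv_rhs => rw [hx, map_sum, map_sum]
  simp [Matrix.mulVec, dotProduct, dFarthestProj, ← tanCoordL_apply, mul_comm]

variable [IsProbabilityMeasure Q]

lemma norm_vw_sub_extMean_le (x : RealProj (d + 1)) : ‖vw x - extMean vw Q‖ ≤ 2 := by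
  have h : ‖extMean vw Q‖ ≤ 1 := by
    have := norm_integral_le_of_norm_le_const (μ := Q) (f := vw) (C := 1)
      (ae_of_all _ fun x => (norm_vw x).le)
    simpa [extMean] using this
  calc _ ≤ ‖vw x‖ + ‖extMean vw Q‖ := norm_sub_le _ _
    _ ≤ 2 := by rw [norm_vw]; linarith

lemma integral_dotProduct_vw_sub (u : Fin (d + 1) × Fin (d + 1) → ℝ) :
    ∫ x, u ⬝ᵥ (vw x - extMean vw Q).ofLp ∂Q = 0 := by
  have hi : ∀ p, Integrable (fun x => vw x p) Q := fun p =>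
    (EuclideanSpace.proj (𝕜 := ℝ) p).integrable_comp
      (Integrable.of_bound measurable_vw.aestronglyMeasurable 1 (ae_of_all _ fun x => (norm_vw x).le))
  simp only [dotProduct, PiLp.sub_apply]
  have hi' : ∀ p, Integrable (fun x => u p * (vw x p - extMean vw Q p)) Q := fun p =>
    ((hi p).sub (integrable_const _)).const_mul _
  rw [integral_finsetSum _ fun p _ => hi' p]
  refine Finset.sum_eq_zero fun p _ => ?_
  rw [integral_const_mul, integral_sub (hi p) (integrable_const _),
    ← extMean_apply measurable_vw (fun x => (norm_vw x).le)]
  simp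

/-- An `o_P` of the squared deviation of the sample mean is negligible. -/
lemma tendsto_zero_of_isLittleO_scaledDev (hYm : ∀ r, Measurable (Y r))
    (hYlaw : ∀ r, P.map (Y r) = Q) (hYind : iIndepFun Y P) {f : ℕ → Ω → ℝ}
    (h : (fun z : ℕ × Ω => f z.1 z.2) =o[inProb P] fun z => ‖scaledDev Q Y z.1 z.2‖ ^ 2) :
    Tendsto (fun z : ℕ × Ω => f z.1 z.2) (inProb P) (𝓝 0) := by
  have hm : ∀ k, Measurable fun ω => vw (Y k ω) - extMean vw Q := fun k =>
    (measurable_vw.comp (hYm k)).sub_const _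
  have h0 : ∀ k p, ∫ ω, (vw (Y k ω) - extMean vw Q) p ∂P = 0 := fun k p => by
    have := integral_dotProduct_vw_sub (Q := Q) (Pi.single p 1)
    simp only [single_one_dotProduct] at this
    rw [← hYlaw k, integral_map (hYm k).aemeasurable] at this
    · rwa [hYlaw k] at this
    · have := measurable_vw (N := d + 1)
      exact Measurable.aestronglyMeasurable (by fun_prop)
  obtain ⟨D, hD, hle⟩ := exists_lintegral_norm_sq_le hm
    (hYind.comp (fun _ x => vw x - extMean vw Q) fun _ => measurable_vw.sub_const _) h0
    (fun k ω => norm_vw_sub_extMean_le (Y k ω))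
  exact tendsto_zero_of_isLittleO_of_lintegral_le
    (fun n => ((measurable_scaledDev hYm n).norm.pow_const 2).aemeasurable) hD hle h

/-- The limit in law of the quadratic form in the linearized antimean. -/
lemma tendstoInDistribution_norm_sq (hYm : ∀ r, Measurable (Y r))
    (hYlaw : ∀ r, P.map (Y r) = Q) (hYind : iIndepFun Y P)
    {e : Fin d → EuclideanSpace ℝ (Fin (d + 1) × Fin (d + 1))}
    (hdet : (anticov vw Q e).det ≠ 0) :
    TendstoInDistribution (fun n ω => (dFarthestProj vw Q e *ᵥ (scaledDev Q Y n ω).ofLp) ⬝ᵥ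
      ((anticov vw Q e)⁻¹ *ᵥ (dFarthestProj vw Q e *ᵥ (scaledDev Q Y n ω).ofLp))) atTop
      (fun x : EuclideanSpace ℝ (Fin d) => ‖x‖ ^ 2) (fun _ => P)
      (stdGaussian (EuclideanSpace ℝ (Fin d))) := by
  set L := dFarthestProj vw Q e
  set S := anticov vw Q e with hS
  have hpd : S.PosDef := posDef_anticov measurable_vw (fun x => (norm_vw x).le) hdet
  set B := invSqrt S * L with hB
  -- Whitening: with `S = LΣLᵗ`, the matrix `B = S^{-1/2}L` gives `BΣBᵗ = S^{-1/2} S S^{-1/2}`.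
  have hBS : B * extCov vw Q * Bᵀ = 1 := by
    have h1 : B * extCov vw Q * Bᵀ = invSqrt S * S * invSqrt S := by
      rw [hB, Matrix.transpose_mul, transpose_invSqrt, hS, anticov]
      simp only [Matrix.mul_assoc]
      rfl
    have h2 : (invSqrt S * invSqrt S) * S = 1 := by
      rw [invSqrt_mul_self hpd, Matrix.nonsing_inv_mul _ hdet.isUnit]
    rw [Matrix.mul_assoc] at h2
    rw [h1, mul_eq_one_comm.1 h2]
  set ξ : ℕ → Ω → EuclideanSpace ℝ (Fin d) :=
    fun k ω => WithLp.toLp 2 (B *ᵥ (vw (Y k ω) - extMean vw Q).ofLp) with hξ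
  have hg : Measurable fun x : RealProj (d + 1) =>
      (WithLp.toLp 2 (B *ᵥ (vw x - extMean vw Q).ofLp) : EuclideanSpace ℝ (Fin d)) := by
    have h1 : Continuous fun y : EuclideanSpace ℝ (Fin (d + 1) × Fin (d + 1)) =>
        (WithLp.toLp 2 (B *ᵥ (y - extMean vw Q).ofLp) : EuclideanSpace ℝ (Fin d)) := by
      have : Continuous fun y : EuclideanSpace ℝ (Fin (d + 1) × Fin (d + 1)) =>
        B *ᵥ (y - extMean vw Q).ofLp := Continuous.matrix_mulVec continuous_const (by fun_prop)
      fun_prop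
    exact h1.measurable.comp measurable_vw
  have hin : ∀ (t : EuclideanSpace ℝ (Fin d)) (y : Fin (d + 1) × Fin (d + 1) → ℝ),
      ⟪(WithLp.toLp 2 (B *ᵥ y) : EuclideanSpace ℝ (Fin d)), t⟫_ℝ = (Bᵀ *ᵥ t.ofLp) ⬝ᵥ y := fun t y => by
    rw [Matrix.mulVec_transpose, ← Matrix.dotProduct_mulVec]
    simp [PiLp.inner_apply, dotProduct]
  have hmap : ∀ {f : RealProj (d + 1) → ℝ}, Measurable f → ∫ ω, f (Y 0 ω) ∂P = ∫ x, f x ∂Q :=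
    fun hf => by rw [← hYlaw 0, integral_map (hYm 0).aemeasurable hf.aestronglyMeasurable]
  have hfm : ∀ u : Fin (d + 1) × Fin (d + 1) → ℝ,
      Measurable fun x : RealProj (d + 1) => u ⬝ᵥ (vw x - extMean vw Q).ofLp := fun u => by
    have := measurable_vw (N := d + 1)
    simp only [dotProduct]
    fun_prop
  have hid : ∀ i, IdentDistrib (Y i) (Y 0) P P := fun i =>
    ⟨(hYm i).aemeasurable, (hYm 0).aemeasurable, by rw [hYlaw, hYlaw]⟩
  have hclt := tendstoInDistribution_stdGaussian (P := P) (ξ := ξ) (fun n => hg.comp (hYm n))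
    (hYind.comp (fun _ => _) fun _ => hg)
    (fun i => (hid i).comp hg) ?_ ?_ ?_
  · have h := hclt.continuous_comp (g := fun x => ‖x‖ ^ 2) (by fun_prop)
    refine h.congr (fun n => ae_of_all _ fun ω => ?_) (ae_of_all _ fun _ => rfl)
    simp only [Function.comp_apply]
    have hsum : (√n)⁻¹ • ∑ k ∈ Finset.range n, ξ k ω =
        WithLp.toLp 2 (invSqrt S *ᵥ (L *ᵥ (scaledDev Q Y n ω).ofLp)) := by
      rw [Matrix.mulVec_mulVec, ← hB, scaledDev, WithLp.ofLp_smul, Matrix.mulVec_smul,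
        WithLp.ofLp_sum, Matrix.mulVec_sum, WithLp.toLp_smul, WithLp.toLp_sum]
    rw [hsum, norm_sq_invSqrt_mulVec hpd]
  · intro t
    simp only [hξ, hin]
    have hc : ∀ x : RealProj (d + 1), ‖(Bᵀ *ᵥ t.ofLp) ⬝ᵥ (vw x - extMean vw Q).ofLp‖ ≤
        ‖(WithLp.toLp 2 (Bᵀ *ᵥ t.ofLp) : EuclideanSpace ℝ _)‖ * 2 := fun x => by
      have h1 : (Bᵀ *ᵥ t.ofLp) ⬝ᵥ (vw x - extMean vw Q).ofLp =
          ⟪(WithLp.toLp 2 (Bᵀ *ᵥ t.ofLp) : EuclideanSpace ℝ _), vw x - extMean vw Q⟫_ℝ := by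
        simp [PiLp.inner_apply, dotProduct, mul_comm]
      rw [h1]
      exact (norm_inner_le_norm _ _).trans (by gcongr; exact norm_vw_sub_extMean_le x)
    exact MemLp.of_bound ((hfm _).comp (hYm 0)).aestronglyMeasurable _ (ae_of_all _ fun ω => hc _)
  · intro t
    simp only [hξ, hin]
    rw [hmap (hfm _), integral_dotProduct_vw_sub]
  · intro t
    simp only [hξ, hin]
    -- The variance in the direction `t` is `tᵗ(BΣBᵗ)t`, which is `‖t‖²` by whitening.
    rw [hmap ((hfm _).pow_const 2), ← dotProduct_extCov_mulVec measurable_vw fun x => (norm_vw x).le,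
      Matrix.mulVec_transpose, ← Matrix.dotProduct_mulVec, ← Matrix.mulVec_transpose,
      Matrix.mulVec_mulVec, Matrix.mulVec_mulVec, hBS, Matrix.one_mulVec,
      EuclideanSpace.real_norm_sq_eq]
    simp [dotProduct, sq]

end Asymptotics

/-! ### Delta method and asymptotic equivalence of the two statistics. -/

section Main

variable {d : ℕ} {Ω : Type*} [MeasurableSpace Ω] {P : Measure Ω} [IsProbabilityMeasure P]
  {Q : Measure (RealProj (d + 1))} {Y : ℕ → Ω → RealProj (d + 1)}
  {U : Set (EuclideanSpace ℝ (Fin (d + 1) × Fin (d + 1)))}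
  {F : EuclideanSpace ℝ (Fin (d + 1) × Fin (d + 1)) →
      Fin (d + 1) → EuclideanSpace ℝ (Fin (d + 1))}

/-- The delta method for the tangential coordinates of the sample antimean. -/
lemma isLittleO_tanCoord_sub (hYm : ∀ r, Measurable (Y r)) (hYlaw : ∀ r, P.map (Y r) = Q)
    (hYind : iIndepFun Y P) (hdiff : DifferentiableAt ℝ (farthestProj vw) (extMean vw Q))
    (e : Fin d → EuclideanSpace ℝ (Fin (d + 1) × Fin (d + 1))) (a : Fin d) :
    (fun z : ℕ × Ω => √z.1 * tanCoord e (farthestProj vw (sampleMean Y z.1 z.2) -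
      farthestProj vw (extMean vw Q)) a -
      (dFarthestProj vw Q e *ᵥ (scaledDev Q Y z.1 z.2).ofLp) a) =o[inProb P]
      fun z => ‖scaledDev Q Y z.1 z.2‖ := by
  -- The deterministic first-order expansion is pulled back along convergence of the sample mean;
  -- multiplying by `√n` turns the error into `o(‖scaledDev‖)`.
  have h1 := hdiff.hasFDerivAt.isLittleO.comp_tendsto (tendsto_sampleMean hYm hYlaw hYind)
  have h2 := (Asymptotics.isBigO_refl (fun z : ℕ × Ω => √(z.1 : ℝ)) (inProb P)).smul_isLittleO h1
  have h3 := ((tanCoordL e a).isBigO_comp (fun z : ℕ × Ω => √(z.1 : ℝ) • (farthestProj vw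
    (sampleMean Y z.1 z.2) - farthestProj vw (extMean vw Q) - fderiv ℝ (farthestProj vw)
    (extMean vw Q) (sampleMean Y z.1 z.2 - extMean vw Q))) (inProb P)).trans_isLittleO h2
  simp only [Function.comp_apply] at h3
  simp only [← scaledDev_eq] at h3
  refine (Asymptotics.IsLittleO.congr_left h3.norm_right fun z => ?_)
  rw [dFarthestProj_mulVec, scaledDev_eq, ← tanCoordL_apply]
  simp only [map_smul, map_sub, smul_eq_mul]
  ring

lemma isBigO_dFarthestProj_mulVec {α : Type*} (l : Filter α)
    (x : α → EuclideanSpace ℝ (Fin (d + 1) × Fin (d + 1)))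
    (e : Fin d → EuclideanSpace ℝ (Fin (d + 1) × Fin (d + 1))) (a : Fin d) :
    (fun z => (dFarthestProj vw Q e *ᵥ (x z).ofLp) a) =O[l] fun z => ‖x z‖ := by
  simp only [dFarthestProj_mulVec]
  exact (((tanCoordL e a).comp (fderiv ℝ (farthestProj vw) (extMean vw Q))).isBigO_comp
    x l).norm_right

/-- On an event of probability tending to `1`, the sample mean lies in the domain of the frame and
the sample anticovariance matrix is invertible. -/
lemma eventually_mem_and_det_ne_zero [IsProbabilityMeasure Q] (hYm : ∀ r, Measurable (Y r))
    (hYlaw : ∀ r, P.map (Y r) = Q) (hYind : iIndepFun Y P)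
    (hF : IsAdaptedFrame U (extMean vw Q) F)
    (hnd : (anticov vw Q (vwFrame (F (extMean vw Q)))).det ≠ 0) :
    ∀ᶠ z in inProb P, sampleMean Y z.1 z.2 ∈ U ∧ (sampleAnticov Y F z.1 z.2).det ≠ 0 := by
  refine ((tendsto_sampleMean hYm hYlaw hYind).eventually hF.mem_nhds).and ?_
  have h := (Continuous.matrix_det continuous_id).tendsto _ |>.comp
    (tendsto_sampleAnticov hYm hYlaw hYind hF)
  exact h.eventually_ne hnd

/-- The statistic is asymptotically the quadratic form in the linearized antimean. -/
lemma isLittleO_statT_sub [IsProbabilityMeasure Q] (hYm : ∀ r, Measurable (Y r))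
    (hYlaw : ∀ r, P.map (Y r) = Q) (hYind : iIndepFun Y P)
    (hF : IsAdaptedFrame U (extMean vw Q) F)
    (hnd : (anticov vw Q (vwFrame (F (extMean vw Q)))).det ≠ 0)
    {e : Fin d → EuclideanSpace ℝ (Fin (d + 1) × Fin (d + 1))}
    (he : vwFrame (F (extMean vw Q)) = e) :
    (fun z : ℕ × Ω => statT Q (F (extMean vw Q)) Y F z.1 z.2 -
      (dFarthestProj vw Q e *ᵥ (scaledDev Q Y z.1 z.2).ofLp) ⬝ᵥ ((anticov vw Q e)⁻¹ *ᵥ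
        (dFarthestProj vw Q e *ᵥ (scaledDev Q Y z.1 z.2).ofLp))) =o[inProb P]
      fun z => ‖scaledDev Q Y z.1 z.2‖ ^ 2 := by
  have hS := tendsto_sampleAnticov hYm hYlaw hYind hF
  rw [he] at hS hnd
  have hinv : Tendsto (fun z : ℕ × Ω => (sampleAnticov Y F z.1 z.2)⁻¹) (inProb P)
      (𝓝 (anticov vw Q e)⁻¹) := by
    have hc : ContinuousAt (fun S : Matrix (Fin d) (Fin d) ℝ => S⁻¹) (anticov vw Q e) := by
      simp only [Matrix.inv_def, Ring.inverse_eq_inv']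
      exact ((Continuous.matrix_det continuous_id).continuousAt.inv₀ hnd).smul
        (Continuous.matrix_adjugate continuous_id).continuousAt
    exact hc.tendsto.comp hS
  have hw := isBigO_dFarthestProj_mulVec (Q := Q) (inProb P) (fun z => scaledDev Q Y z.1 z.2) e
  have hr := isLittleO_tanCoord_sub hYm hYlaw hYind
    (hF.contDiffAt_farthestProj.differentiableAt one_ne_zero) e
  have h := isLittleO_dotProduct_mulVec_sub (v := fun (z : ℕ × Ω) a => √(z.1 : ℝ) *
    tanCoord e (farthestProj vw (sampleMean Y z.1 z.2) - farthestProj vw (extMean vw Q)) a)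
    hinv hw hr
  refine h.congr' ?_ .rfl
  filter_upwards [eventually_mem_and_det_ne_zero hYm hYlaw hYind hF (by rwa [he])] with z hz
  rw [statT_eq _ _ hz.2, he]
  congr 1
  set u := tanCoord e (farthestProj vw (sampleMean Y z.1 z.2) - farthestProj vw (extMean vw Q))
  -- The two factors `√n` combine into the factor `n` of the statistic.
  change (√(z.1 : ℝ) • u) ⬝ᵥ (_ *ᵥ (√(z.1 : ℝ) • u)) = _
  rw [Matrix.mulVec_smul, smul_dotProduct, dotProduct_smul, smul_smul,
    Real.mul_self_sqrt (Nat.cast_nonneg _), smul_eq_mul]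

/-- The two statistics are asymptotically equivalent. -/
lemma isLittleO_statT_sub_quadT [IsProbabilityMeasure Q] (hYm : ∀ r, Measurable (Y r))
    (hYlaw : ∀ r, P.map (Y r) = Q) (hYind : iIndepFun Y P)
    (hF : IsAdaptedFrame U (extMean vw Q) F)
    (hnd : (anticov vw Q (vwFrame (F (extMean vw Q)))).det ≠ 0) :
    (fun z : ℕ × Ω => statT Q (F (extMean vw Q)) Y F z.1 z.2 -
      quadT (F (extMean vw Q)) Y F z.1 z.2) =o[inProb P] fun z => ‖scaledDev Q Y z.1 z.2‖ ^ 2 := by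
  have h0 := mem_of_mem_nhds hF.mem_nhds
  set ν := F (extMean vw Q) with hν
  set c : ℕ × Ω → ℝ := fun z => ⟪ν 0, F (sampleMean Y z.1 z.2) 0⟫_ℝ ^ 2
  have hc : Tendsto c (inProb P) (𝓝 1) := by
    have h1 : ContinuousAt (fun A => ⟪ν 0, F A 0⟫_ℝ ^ 2) (extMean vw Q) :=
      (continuousAt_const.inner hF.contDiffAt_zero.continuousAt).pow 2
    have h2 := h1.tendsto.comp (tendsto_sampleMean hYm hYlaw hYind)
    rwa [← hν, real_inner_self_eq_norm_sq, (hF.orthonormal _ h0).1 0, one_pow, one_pow] at h2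
  have hT : (fun z : ℕ × Ω => statT Q ν Y F z.1 z.2) =O[inProb P]
      fun z => ‖scaledDev Q Y z.1 z.2‖ ^ 2 := by
    have h1 := (isLittleO_statT_sub hYm hYlaw hYind hF hnd rfl).isBigO.add
      (isBigO_dotProduct_mulVec (isBigO_dFarthestProj_mulVec (Q := Q) (inProb P)
        (fun z => scaledDev Q Y z.1 z.2) (vwFrame ν))
        (anticov vw Q (vwFrame ν))⁻¹)
    exact h1.congr_left fun z => sub_add_cancel _ _
  -- Where `T = c T̃` and `c ≠ 0`, the difference `T - T̃` equals `(1 - c⁻¹) T`, a product of `o(1)`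
  -- with a quantity whose order is already known.
  have hd : (fun z => 1 - (c z)⁻¹) =o[inProb P] fun _ => (1 : ℝ) := by
    rw [Asymptotics.isLittleO_one_iff]
    simpa using (hc.inv₀ one_ne_zero).const_sub 1
  have h := hd.mul_isBigO hT
  simp only [one_mul] at h
  refine h.congr' ?_ .rfl
  filter_upwards [eventually_mem_and_det_ne_zero hYm hYlaw hYind hF hnd,
    hc.eventually_ne one_ne_zero] with z hz hcz
  have h3 : statT Q ν Y F z.1 z.2 = c z * quadT ν Y F z.1 z.2 :=
    statT_eq_mul_quadT (hF.orthonormal _ h0) hF rfl z.1 z.2 hz.1 hz.2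
  rw [sub_mul, one_mul, h3, inv_mul_cancel_left₀ hcz]

end Main

end

theorem mainTheorem5 {d : ℕ} {Ω : Type*} [MeasurableSpace Ω] (P : Measure Ω)
    [IsProbabilityMeasure P]
    -- a distribution on `ℝP^{N-1}`, with `N = d + 1`, and a random sample from it
    (Q : Measure (RealProj (d + 1))) [IsProbabilityMeasure Q]
    (Y : ℕ → Ω → RealProj (d + 1)) (hYm : ∀ r, Measurable (Y r))
    (hYlaw : ∀ r, P.map (Y r) = Q) (hYind : iIndepFun Y P)
    (hQ : IsAntiNonfocal vw (extMean vw Q))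
    -- orthonormal eigenvectors of `E(X Xᵗ)`, for the eigenvalues in increasing order
    (l : Fin (d + 1) → ℝ) (hl : Monotone l)
    (ν : Fin (d + 1) → EuclideanSpace ℝ (Fin (d + 1))) (hν : Orthonormal ℝ ν)
    (heig : ∀ a, asMatrix (extMean vw Q) *ᵥ (ν a).ofLp = l a • (ν a).ofLp)
    -- the anticovariance matrix of `Q` is nondegenerate
    (hnd : (anticov vw Q (vwFrame ν)).det ≠ 0)
    -- an adapted moving frame near `E(X Xᵗ)` that extends `ν`
    (U : Set (EuclideanSpace ℝ (Fin (d + 1) × Fin (d + 1))))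
    (F : EuclideanSpace ℝ (Fin (d + 1) × Fin (d + 1)) →
      Fin (d + 1) → EuclideanSpace ℝ (Fin (d + 1)))
    (hF : IsAdaptedFrame U (extMean vw Q) F) (hFν : F (extMean vw Q) = ν) :
    (∀ n ω, sampleMean Y n ω ∈ U → (sampleAnticov Y F n ω).det ≠ 0 →
      statT Q ν Y F n ω = ⟪ν 0, F (sampleMean Y n ω) 0⟫_ℝ ^ 2 * quadT ν Y F n ω) ∧
    Tendsto (fun n => P {ω | sampleMean Y n ω ∈ U ∧ (sampleAnticov Y F n ω).det ≠ 0})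
      atTop (𝓝 1) ∧
    TendstoInMeasure P (fun n ω => statT Q ν Y F n ω - quadT ν Y F n ω) atTop (fun _ => 0) ∧
    HasAsymptoticLaw P (statT Q ν Y F) (chiSq d) ∧
    HasAsymptoticLaw P (quadT ν Y F) (chiSq d) := by
  subst hFν
  have hlim := tendstoInDistribution_norm_sq hYm hYlaw hYind hnd
  have hT : Tendsto (fun z : ℕ × Ω => statT Q (F (extMean vw Q)) Y F z.1 z.2 -
      quadT (F (extMean vw Q)) Y F z.1 z.2) (inProb P) (𝓝 0) :=
    tendsto_zero_of_isLittleO_scaledDev hYm hYlaw hYind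
      (f := fun n ω => statT Q (F (extMean vw Q)) Y F n ω - quadT (F (extMean vw Q)) Y F n ω)
      (isLittleO_statT_sub_quadT hYm hYlaw hYind hF hnd)
  have hW := tendsto_zero_of_isLittleO_scaledDev hYm hYlaw hYind
    (f := fun n ω => statT Q (F (extMean vw Q)) Y F n ω -
      (dFarthestProj vw Q (vwFrame (F (extMean vw Q))) *ᵥ (scaledDev Q Y n ω).ofLp) ⬝ᵥ
        ((anticov vw Q (vwFrame (F (extMean vw Q))))⁻¹ *ᵥ
          (dFarthestProj vw Q (vwFrame (F (extMean vw Q))) *ᵥ (scaledDev Q Y n ω).ofLp)))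
    (isLittleO_statT_sub hYm hYlaw hYind hF hnd rfl)
  refine ⟨fun n ω hU hdet => statT_eq_mul_quadT hν hF rfl n ω hU hdet,
    tendsto_measure_one_of_eventually_inProb
      (eventually_mem_and_det_ne_zero hYm hYlaw hYind hF hnd),
    (tendsto_inProb_iff (f := fun n ω => statT Q (F (extMean vw Q)) Y F n ω -
      quadT (F (extMean vw Q)) Y F n ω)).1 hT, ?_, ?_⟩
  · rw [← map_norm_sq_stdGaussian]
    exact HasAsymptoticLaw.of_tendstoInDistribution hlim hW
  · rw [← map_norm_sq_stdGaussian]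
    refine HasAsymptoticLaw.of_tendstoInDistribution hlim ?_
    -- With `W` the linearized form, `T̃ - W = (T - W) - (T - T̃)`, so `T̃` has the same limit law
    -- as `T`.
    have h := hW.sub hT
    rw [sub_zero] at h
    exact h.congr fun z => sub_sub_sub_cancel_left _ _ (_ : ℝ)
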